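/- Let $A$ be a $C^*$-algebra (not necessarily unital) with multiplier algebra $M(A)$. An *Exel system* $(A,\alpha,L)$ consists of an endomorphism $\alpha:A\to A$ (a $*$-homomorphism) which extends to a strictly continuous endomorphism of $M(A)$, and a *transfer operator* $L$ for $(A,\alpha)$, i.e. a bounded positive linear map $L:A\to A$ which extends to a bounded positive linear map $\overline L:M(A)\to M(A)$ such that $L(\alpha(a)m)=a\,\overline L(m)$ for all $a\in A$, $m\in M(A)$. *The ideal $K_\alpha$.* Let $A_L$ be a copy of $A$ with the right action $m\cdot a=m\alpha(a)$ and the $A$-valued pairing $\langle m,n\rangle_L=L(m^*n)$, let $M_L$ be the Hilbert $A$-module obtained by completing $A_L$, with canonical map $q:A_L\to M_L$, and let $\phi(a)$ be the operator on $M_L$ with $\phi(a)q(b)=q(ab)$. Let $\mathcal K(M_L)$ be the closed linear span of the operators $\Theta_{x,y}:z\mapsto x\cdot\langle y,z\rangle$, $x,y\in M_L$, put $J(M_L)=\phi^{-1}(\mathcal K(M_L))$, and let $$K_\alpha=\overline{A\alpha(A)A}\cap J(M_L),$$ where here and below the bar denotes the closed linear span of the set of products. *The crossed product.* A *Toeplitz-covariant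 representation* of $(A,\alpha,L)$ in a $C^*$-algebra $B$ is a pair $(\pi,V)$ of a nondegenerate homomorphism $\pi:A\to B$ and an element $V\in M(B)$ such that $V\pi(a)=\pi(\alpha(a))V$ and $V^*\pi(a)V=\pi(L(a))$ for all $a\in A$. Let $\mathcal T(A,\alpha,L)$ be the $C^*$-algebra generated by a universal Toeplitz-covariant representation $(i,S)$, that is, generated by $i(A)\cup i(A)S$. A pair $(i(a),k)$ with $a\in A$ and $k\in\mathcal T(A,\alpha,L)$ is a *redundancy* if $k\in\overline{i(A)SS^*i(A)}$ and $i(a)i(b)S=k\,i(b)S$ for all $b\in A$. Let $I(A,\alpha,L)$ be the closed two-sided ideal of $\mathcal T(A,\alpha,L)$ generated by the elements $i(a)-k$ such that $(i(a),k)$ is a redundancy and $a\in\overline{A\alpha(A)A}$. The crossed product is $A\rtimes_{\alpha,L}\mathbb N=\mathcal T(A,\alpha,L)/I(A,\alpha,L)$, with quotient map $Q$. **Theorem.** Let $(A,\alpha,L)$ be an Exel system. 1. The canonical map $Q\circ i:A\to A\rtimes_{\alpha,L}\mathbb N$ is injective if and only if $L$ is almost faithful on $K_\alpha$, i.e. if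 and only if $$a\in K_\alpha\text{ and }L((ab)^*ab)=0\text{ for all }b\in A\implies a=0.$$ 2. If $A$ is commutative, then $Q\circ i$ is injective if and only if $L$ is faithful on $K_\alpha$, i.e. if and only if $$a\in K_\alpha\text{ and }L(a^*a)=0\implies a=0.$$ -/

import Mathlib

open scoped MultiplierAlgebra ENNReal

universe u v

/-- A map between `C⋆`-algebras is positive if it sends positive elements, i.e. those of the form
`star b * b`, to positive elements. -/
def IsPositiveMap {B C : Type*} [Mul B] [Star B] [Mul C] [Star C] (T : B → C) : Prop :=
  ∀ b : B, ∃ c : C, T (star b * b) = star c * c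

/-- The strict topology on the multiplier algebra `M(A)`, i.e. the topology generated by the
seminorms `m ↦ ‖m a‖` and `m ↦ ‖a m‖` for `a ∈ A`. Here `m.fst a = m a` and `m.snd a = a m`. -/
@[reducible] noncomputable def strictTopology (A : Type u) [NonUnitalCStarAlgebra A] : TopologicalSpace 𝓜(ℂ, A) :=
  TopologicalSpace.induced
    (fun m : 𝓜(ℂ, A) => ((m.fst : A → A), (m.snd : A → A))) inferInstance

/-- An Exel system `(A, α, L)`: an extendible endomorphism `α` of the `C⋆`-algebra `A` and a
transfer operator `L` for it. -/
structure ExelSystem (A : Type u) [NonUnitalCStarAlgebra A] where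
  /-- the endomorphism -/
  α : A →⋆ₙₐ[ℂ] A
  /-- the transfer operator, a bounded linear map -/
  L : A →L[ℂ] A
  /-- `α` extends to a strictly continuous endomorphism of `M(A)` -/
  extendible : ∃ αbar : 𝓜(ℂ, A) →⋆ₙₐ[ℂ] 𝓜(ℂ, A),
    @Continuous _ _ (strictTopology A) (strictTopology A) αbar ∧
      ∀ a : A, αbar (a : 𝓜(ℂ, A)) = (α a : 𝓜(ℂ, A))
  positive : IsPositiveMap L
  /-- `L` extends to a bounded positive linear map `Lbar` of `M(A)` with
  `L (α(a) m) = a Lbar(m)` for `a ∈ A` and `m ∈ M(A)`. -/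
  transfer : ∃ Lbar : 𝓜(ℂ, A) →L[ℂ] 𝓜(ℂ, A), IsPositiveMap Lbar ∧
    (∀ a : A, Lbar (a : 𝓜(ℂ, A)) = (L a : 𝓜(ℂ, A))) ∧
      ∀ (a : A) (m : 𝓜(ℂ, A)), L (m.snd (α a)) = (Lbar m).snd a

namespace ExelSystem

variable {A : Type u} [NonUnitalCStarAlgebra A] (E : ExelSystem A)

/-! ### The Hilbert bimodule `M_L` -/

theorem L_map_mul (a m : A) : E.L (E.α a * m) = a * E.L m := by
  obtain ⟨Lbar, -, h1, h2⟩ := E.transfer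
  simpa [h1] using h2 a (m : 𝓜(ℂ, A))

theorem isSelfAdjoint_L (b : A) : star (E.L (star b * b)) = E.L (star b * b) := by
  obtain ⟨c, hc⟩ := E.positive b
  rw [hc]; simp

/-- Hermitian symmetry of the pairing `⟨x, y⟩_L = L(x* y)`. -/
theorem star_L (x y : A) : star (E.L (star x * y)) = E.L (star y * x) := by
  have h1 := E.isSelfAdjoint_L (x + y)
  have h2 := E.isSelfAdjoint_L (x + Complex.I • y)
  have hx := E.isSelfAdjoint_L x
  have hy := E.isSelfAdjoint_L y
  simp only [star_add, add_mul, mul_add, map_add, star_smul, smul_mul_assoc, mul_smul_comm,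
    map_smul, hx, hy] at h1 h2
  simp only [RCLike.star_def, Complex.conj_I, map_neg, neg_neg] at h2
  set p := E.L (star x * y)
  set q := E.L (star y * x)
  set r := E.L (star x * x)
  set s := E.L (star y * y)
  have e1 : star p + star q = p + q := by
    have := congrArg (fun t => t - r - s) h1
    calc star p + star q = r + star q + (star p + s) - r - s := by abel
      _ = r + q + (p + s) - r - s := this
      _ = p + q := by abel
  have e2 : star p - star q = q - p := by
    have h3 := congrArg (fun t => Complex.I • (t - r - s)) h2
    simp only [neg_smul, smul_smul, smul_add, smul_sub, smul_neg, neg_mul,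
      Complex.I_mul_I, neg_neg, one_smul] at h3
    calc star p - star q = Complex.I • r + -star q + (star p + Complex.I • s) - Complex.I • r
          - Complex.I • s := by abel
      _ = Complex.I • r + q + (-p + Complex.I • s) - Complex.I • r - Complex.I • s := h3
      _ = q - p := by abel
  have e3 : (2 : ℂ) • star p = (2 : ℂ) • q := by
    rw [two_smul, two_smul]
    calc star p + star p = (star p + star q) + (star p - star q) := by abel
      _ = (p + q) + (q - p) := by rw [e1, e2]
      _ = q + q := by abel
  exact smul_right_injective A (two_ne_zero (α := ℂ)) e3

theorem L_mul_map (x y a : A) : E.L (star x * (y * E.α a)) = E.L (star x * y) * a := by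
  have h : star x * (y * E.α a) = star (star y * x) * E.α a := by simp [mul_assoc]
  rw [h, ← star_star (E.L _), E.star_L, ← map_star E.α, E.L_map_mul, star_mul, star_star, E.star_L]

/-- The bound which makes left multiplication by `a` continuous for the seminorm of `A_L`. -/
theorem norm_L_le (a x : A) :
    ‖E.L (star (a * x) * (a * x))‖ ≤ ‖a‖ ^ 2 * ‖E.L (star x * x)‖ := by
  let _ := CStarAlgebra.spectralOrder A
  let _ := CStarAlgebra.spectralOrderedRing A
  have hpos : ∀ b : A, 0 ≤ b → 0 ≤ E.L b := by
    intro b hb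
    obtain ⟨c, rfl⟩ := CStarAlgebra.nonneg_iff_eq_star_mul_self.1 hb
    obtain ⟨d, hd⟩ := E.positive c
    rw [hd]; exact star_mul_self_nonneg d
  have h1 : star (a * x) * (a * x) ≤ (‖a‖ ^ 2 : ℝ) • (star x * x) := by
    have := CStarAlgebra.star_left_conjugate_le_norm_smul (a := x) (b := star a * a)
      (hb := IsSelfAdjoint.star_mul_self a)
    rw [CStarRing.norm_star_mul_self, ← sq] at this
    simpa [mul_assoc] using this
  have h2 : E.L (star (a * x) * (a * x)) ≤ (‖a‖ ^ 2 : ℝ) • E.L (star x * x) := by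
    have := hpos _ (sub_nonneg.2 h1)
    rw [map_sub, sub_nonneg] at this
    refine this.trans_eq ?_
    exact map_real_smul E.L.toLinearMap.toAddMonoidHom E.L.continuous _ _
  have := CStarAlgebra.norm_le_norm_of_nonneg_of_le (hpos _ (star_mul_self_nonneg _)) h2
  rwa [norm_smul, Real.norm_of_nonneg (by positivity)] at this

/-- The Cauchy-Schwarz inequality for the pairing. -/
theorem norm_L_sq_le (x y : A) :
    ‖E.L (star x * y)‖ ^ 2 ≤ ‖E.L (star x * x)‖ * ‖E.L (star y * y)‖ := by
  let _ := CStarAlgebra.spectralOrder A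
  let _ := CStarAlgebra.spectralOrderedRing A
  suffices h : ∀ c : ℝ, ‖E.L (star x * x)‖ < c → ‖E.L (star x * y)‖ ^ 2 ≤ c * ‖E.L (star y * y)‖ by
    refine ge_of_tendsto (x := nhdsWithin ‖E.L (star x * x)‖ (Set.Ioi _))
      (f := fun c : ℝ => c * ‖E.L (star y * y)‖) ?_ (by filter_upwards [self_mem_nhdsWithin] with c hc using h c hc)
    exact ((continuous_id.mul continuous_const).tendsto _).mono_left nhdsWithin_le_nhds
  intro c hc
  have hc0 : 0 < c := (norm_nonneg _).trans_lt hc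
  set b := E.L (star x * y) with hb
  -- expand the positive element `⟨x b - c y, x b - c y⟩`
  have h0 : 0 ≤ E.L (star (x * E.α b - (c : ℂ) • y) * (x * E.α b - (c : ℂ) • y)) := by
    obtain ⟨d, hd⟩ := E.positive (x * E.α b - (c : ℂ) • y)
    rw [hd]; exact star_mul_self_nonneg d
  have hexp : E.L (star (x * E.α b - (c : ℂ) • y) * (x * E.α b - (c : ℂ) • y)) =
      star b * E.L (star x * x) * b - (c : ℂ) • (star b * b) - (c : ℂ) • (star b * b)
        + (c : ℂ) • (c : ℂ) • E.L (star y * y) := by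
    have e1 : E.L (star (x * E.α b) * (x * E.α b)) = star b * E.L (star x * x) * b := by
      rw [E.L_mul_map, star_mul, mul_assoc, ← map_star, E.L_map_mul]
    have e2 : E.L (star (x * E.α b) * y) = star b * b := by
      rw [star_mul, mul_assoc, ← map_star, E.L_map_mul]
    have e3 : E.L (star y * (x * E.α b)) = star b * b := by
      rw [E.L_mul_map, ← E.star_L x y]
    rw [star_sub, sub_mul, mul_sub, mul_sub, star_smul, smul_mul_assoc, smul_mul_assoc,
      mul_smul_comm, mul_smul_comm]
    simp only [map_sub, map_smul, e1, e2, e3]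
    simp only [RCLike.star_def, Complex.conj_ofReal]
    abel
  have h1 : star b * E.L (star x * x) * b ≤ c • (star b * b) := by
    refine (CStarAlgebra.star_left_conjugate_le_norm_smul (E.isSelfAdjoint_L x)).trans ?_
    exact smul_le_smul_of_nonneg_right hc.le (star_mul_self_nonneg b)
  have h2 : c • (star b * b) ≤ c • c • E.L (star y * y) := by
    rw [hexp] at h0
    simp only [Complex.coe_smul] at h0
    rw [← sub_nonneg]
    refine h0.trans ?_
    rw [← sub_nonneg]
    convert sub_nonneg.2 h1 using 1
    abel
  have h3 := CStarAlgebra.norm_le_norm_of_nonneg_of_le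
    (smul_nonneg hc0.le (star_mul_self_nonneg b)) h2
  rw [norm_smul, norm_smul, norm_smul, Real.norm_of_nonneg hc0.le, CStarRing.norm_star_mul_self,
    ← sq] at h3
  exact le_of_mul_le_mul_left h3 hc0

/-- Right multiplication by `α(a)` is continuous for the seminorm of `A_L`. -/
theorem norm_L_mul_map_le (a x : A) :
    ‖E.L (star (x * E.α a) * (x * E.α a))‖ ≤ ‖a‖ ^ 2 * ‖E.L (star x * x)‖ := by
  rw [E.L_mul_map, star_mul, mul_assoc, ← map_star E.α, E.L_map_mul]
  calc ‖star a * E.L (star x * x) * a‖ ≤ ‖star a‖ * ‖E.L (star x * x)‖ * ‖a‖ :=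
        (norm_mul_le _ _).trans (by gcongr; exact norm_mul_le _ _)
    _ = ‖a‖ ^ 2 * ‖E.L (star x * x)‖ := by rw [norm_star]; ring

/-- The pre-inner-product module `A_L`: a copy of `A`, with right action `m · a = m α(a)` and
pairing `⟨m, n⟩_L = L(m* n)`, seminormed by `‖m‖ = ‖⟨m, m⟩_L‖ ^ (1/2)`. -/
def PreModule (_E : ExelSystem A) : Type u := A

namespace PreModule

noncomputable instance : AddCommGroup E.PreModule := inferInstanceAs (AddCommGroup A)

noncomputable instance : Module ℂ E.PreModule := inferInstanceAs (Module ℂ A)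

/-- The identification of `A` with `A_L`. -/
def of : A ≃ₗ[ℂ] E.PreModule := LinearEquiv.refl ℂ A

noncomputable instance : Norm E.PreModule where
  norm x := √‖E.L (star ((of E).symm x) * (of E).symm x)‖

theorem norm_of (x : A) : ‖of E x‖ = √‖E.L (star x * x)‖ := rfl

theorem norm_of_sq (x : A) : ‖of E x‖ ^ 2 = ‖E.L (star x * x)‖ := by
  rw [norm_of, Real.sq_sqrt (norm_nonneg _)]

theorem norm_L_le_mul (x y : A) : ‖E.L (star x * y)‖ ≤ ‖of E x‖ * ‖of E y‖ := by
  rw [norm_of, norm_of, ← Real.sqrt_mul (norm_nonneg _)]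
  exact Real.le_sqrt_of_sq_le (E.norm_L_sq_le x y)

theorem core : SeminormedSpace.Core ℂ E.PreModule where
  norm_nonneg _ := Real.sqrt_nonneg _
  norm_smul c x := by
    obtain ⟨x, rfl⟩ := (of E).surjective x
    rw [← map_smul, norm_of, norm_of, star_smul, smul_mul_assoc, mul_smul_comm, map_smul, map_smul,
      norm_smul, norm_smul, norm_star, ← mul_assoc, Real.sqrt_mul (by positivity),
      Real.sqrt_mul_self (norm_nonneg c)]
  norm_triangle x y := by
    obtain ⟨x, rfl⟩ := (of E).surjective x
    obtain ⟨y, rfl⟩ := (of E).surjective y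
    have hx : 0 ≤ ‖of E x‖ := Real.sqrt_nonneg _
    have hy : 0 ≤ ‖of E y‖ := Real.sqrt_nonneg _
    refine le_of_sq_le_sq ?_ (add_nonneg hx hy)
    rw [← map_add, norm_of_sq, star_add, add_mul, mul_add, mul_add, map_add, map_add, map_add]
    have h1 := norm_L_le_mul E x x
    have h2 := norm_L_le_mul E x y
    have h3 := norm_L_le_mul E y x
    have h4 := norm_L_le_mul E y y
    have := norm_add₄_le (a := E.L (star x * x)) (b := E.L (star x * y))
      (c := E.L (star y * x)) (d := E.L (star y * y))
    rw [← add_assoc]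
    nlinarith

noncomputable instance : SeminormedAddCommGroup E.PreModule :=
  SeminormedAddCommGroup.ofCore (core E)

noncomputable instance : NormedSpace ℂ E.PreModule where
  norm_smul_le c x := ((core E).norm_smul c x).le

/-- The pairing `⟨m, n⟩_L = L(m* n)` as a bounded sesquilinear map. -/
noncomputable def inner : E.PreModule →L⋆[ℂ] E.PreModule →L[ℂ] A :=
  LinearMap.mkContinuous₂
    (LinearMap.mk₂'ₛₗ (starRingEnd ℂ) (RingHom.id ℂ)
      (fun x y => E.L (star ((of E).symm x) * (of E).symm y))
      (fun x x' y => by simp [add_mul])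
      (fun c x y => by simp [smul_mul_assoc, -smul_eq_mul])
      (fun x y y' => by simp [mul_add]) (fun c x y => by simp [mul_smul_comm]))
    1 (fun x y => by simpa using norm_L_le_mul E ((of E).symm x) ((of E).symm y))

/-- The left action `a · m = a m`, as a bounded bilinear map. -/
noncomputable def left : A →L[ℂ] E.PreModule →L[ℂ] E.PreModule :=
  LinearMap.mkContinuous₂
    (LinearMap.mk₂ ℂ (fun a x => of E (a * (of E).symm x))
      (fun x x' y => by simp [add_mul]) (fun c x y => by simp [smul_mul_assoc])
      (fun x y y' => by simp [mul_add]) (fun c x y => by simp [mul_smul_comm]))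
    1 (fun a x => by
      have := Real.sqrt_le_sqrt (E.norm_L_le a ((of E).symm x))
      rw [Real.sqrt_mul (by positivity), Real.sqrt_sq (norm_nonneg a)] at this
      rw [one_mul]; exact this)

/-- The right action `m · a = m α(a)`, as a bounded bilinear map. -/
noncomputable def right : A →L[ℂ] E.PreModule →L[ℂ] E.PreModule :=
  LinearMap.mkContinuous₂
    (LinearMap.mk₂ ℂ (fun a x => of E ((of E).symm x * E.α a))
      (fun x x' y => by simp [mul_add]) (fun c x y => by simp [mul_smul_comm])
      (fun x y y' => by simp [add_mul]) (fun c x y => by simp [smul_mul_assoc]))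
    1 (fun a x => by
      have := Real.sqrt_le_sqrt (E.norm_L_mul_map_le a ((of E).symm x))
      rw [Real.sqrt_mul (by positivity), Real.sqrt_sq (norm_nonneg a)] at this
      rw [one_mul]; exact this)

end PreModule

/-- The Hilbert bimodule `M_L`: the (Hausdorff) completion of `A_L`. -/
abbrev M : Type u := UniformSpace.Completion E.PreModule

/-- The canonical map `q : A_L → M_L`. -/
noncomputable def qL : E.PreModule →L[ℂ] E.M := UniformSpace.Completion.toComplL

/-- The canonical map `q`, with domain written as `A`. -/
noncomputable def q (x : A) : E.M := E.qL (PreModule.of E x)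

theorem denseRange_qL : DenseRange E.qL := UniformSpace.Completion.denseRange_coe

theorem isUniformInducing_qL : IsUniformInducing E.qL :=
  UniformSpace.Completion.isUniformInducing_coe _

/-- The `A`-valued inner product of `M_L`, extending `⟨m, n⟩_L = L(m* n)` by continuity. -/
noncomputable def inner : E.M →L⋆[ℂ] E.M →L[ℂ] A :=
  ((((PreModule.inner E).extend E.qL).flip).extend E.qL).flip

/-- The right action of `A` on `M_L`: `E.right x a` is `x · a`. -/
noncomputable def right : E.M →L[ℂ] A →L[ℂ] E.M :=
  (((ContinuousLinearMap.compL ℂ E.PreModule E.PreModule E.M E.qL).comp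
    (PreModule.right E)).flip).extend E.qL

/-- The homomorphism `φ` of `A` into the bounded operators on `M_L` which implements the left
action `φ(a)(q(b)) = q(a b)`. -/
noncomputable def φ : A →L[ℂ] E.M →L[ℂ] E.M :=
  ((((ContinuousLinearMap.compL ℂ E.PreModule E.PreModule E.M E.qL).comp
    (PreModule.left E)).flip).extend E.qL).flip

theorem inner_q_q (x y : A) : E.inner (E.q x) (E.q y) = E.L (star x * y) := by
  simp only [inner, q, ContinuousLinearMap.flip_apply]
  rw [ContinuousLinearMap.extend_eq _ E.denseRange_qL E.isUniformInducing_qL,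
    ContinuousLinearMap.flip_apply,
    ContinuousLinearMap.extend_eq _ E.denseRange_qL E.isUniformInducing_qL]
  rfl

theorem right_q (x a : A) : E.right (E.q x) a = E.q (x * E.α a) := by
  simp only [right, q]
  rw [ContinuousLinearMap.extend_eq _ E.denseRange_qL E.isUniformInducing_qL]
  rfl

theorem φ_q (a x : A) : E.φ a (E.q x) = E.q (a * x) := by
  simp only [φ, q, ContinuousLinearMap.flip_apply]
  rw [ContinuousLinearMap.extend_eq _ E.denseRange_qL E.isUniformInducing_qL]
  rfl

/-- The rank-one operator `Θ_{x,y} : z ↦ x · ⟨y, z⟩` on `M_L`. -/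
noncomputable def Θ (x y : E.M) : E.M →L[ℂ] E.M := (E.right x).comp (E.inner y)

/-- `K(M_L)`: the closed linear span of the operators `Θ_{x,y}`, in the operator norm. -/
noncomputable def compactOperators : Submodule ℂ (E.M →L[ℂ] E.M) :=
  (Submodule.span ℂ {T | ∃ x y : E.M, T = E.Θ x y}).topologicalClosure

/-- The ideal `J(M_L) = φ⁻¹(K(M_L))` of `A`. -/
noncomputable def J : Submodule ℂ A := E.compactOperators.comap E.φ.toLinearMap

/-- The closed linear span of `A α(A) A`. -/
noncomputable def closureAαA : Submodule ℂ A :=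
  (Submodule.span ℂ {x | ∃ a b c : A, x = a * E.α b * c}).topologicalClosure

/-- The ideal `K_α`, the intersection of the closed linear span of `A α(A) A` with `J(M_L)`. -/
noncomputable def Kα : Submodule ℂ A := E.closureAαA ⊓ E.J

/-- `L` is faithful on `I`. -/
def FaithfulOn (I : Submodule ℂ A) : Prop :=
  ∀ a ∈ I, E.L (star a * a) = 0 → a = 0

/-- `L` is almost faithful on `I`. -/
def AlmostFaithfulOn (I : Submodule ℂ A) : Prop :=
  ∀ a ∈ I, (∀ b : A, E.L (star (a * b) * (a * b)) = 0) → a = 0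

end ExelSystem

/-! ### Toeplitz-covariant representations and the Toeplitz crossed product -/

/-- A Toeplitz-covariant representation `(π, V)` of `(A, α, L)` in a `C⋆`-algebra `B`: a
nondegenerate homomorphism `π : A → B` and a multiplier `V ∈ M(B)` with
`V π(a) = π(α(a)) V` and `V* π(a) V = π(L(a))` in `M(B)`. -/
structure ToeplitzRep {A : Type u} [NonUnitalCStarAlgebra A] (E : ExelSystem A)
    (B : Type v) [NonUnitalCStarAlgebra B] where
  π : A →⋆ₙₐ[ℂ] B
  /-- `π(A) B` spans a dense subspace of `B` -/
  nondegenerate :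
    (Submodule.span ℂ {x : B | ∃ (a : A) (b : B), x = π a * b}).topologicalClosure = ⊤
  V : 𝓜(ℂ, B)
  tc1 : ∀ a : A, V * (π a : 𝓜(ℂ, B)) = (π (E.α a) : 𝓜(ℂ, B)) * V
  tc2 : ∀ a : A, star V * (π a : 𝓜(ℂ, B)) * V = (π (E.L a) : 𝓜(ℂ, B))

section Multipliers

variable {B : Type v} [NonUnitalCStarAlgebra B]

theorem eq_of_forall_mul_right {x y : B} (h : ∀ z : B, x * z = y * z) : x = y := by
  have h1 := h (star (x - y))
  rw [← sub_eq_zero, ← sub_mul, CStarRing.mul_star_self_eq_zero_iff, sub_eq_zero] at h1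
  exact h1

theorem eq_of_forall_mul_left {x y : B} (h : ∀ z : B, z * x = z * y) : x = y := by
  have h1 := h (star (x - y))
  rw [← sub_eq_zero, ← mul_sub, CStarRing.star_mul_self_eq_zero_iff, sub_eq_zero] at h1
  exact h1

theorem multiplier_snd_mul (m : 𝓜(ℂ, B)) (x y : B) : m.snd (x * y) = x * m.snd y :=
  eq_of_forall_mul_right fun z => by rw [m.central, mul_assoc, mul_assoc, m.central]

theorem multiplier_fst_mul (m : 𝓜(ℂ, B)) (x y : B) : m.fst (x * y) = m.fst x * y :=
  eq_of_forall_mul_left fun z => by rw [← m.central, ← mul_assoc, ← mul_assoc, m.central]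

theorem multiplier_coe_injective {x y : B} (h : (x : 𝓜(ℂ, B)) = (y : 𝓜(ℂ, B))) : x = y :=
  eq_of_forall_mul_right fun z => by
    simpa using congrArg (fun m : 𝓜(ℂ, B) => m.fst z) h

theorem multiplier_coe_mul_coe (x y : B) : ((x * y : B) : 𝓜(ℂ, B)) = (x : 𝓜(ℂ, B)) * (y : 𝓜(ℂ, B)) :=
  map_mul (DoubleCentralizer.coeHom (𝕜 := ℂ)) x y

theorem multiplier_coe_star (x : B) : ((star x : B) : 𝓜(ℂ, B)) = star (x : 𝓜(ℂ, B)) :=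
  map_star (DoubleCentralizer.coeHom (𝕜 := ℂ)) x

theorem multiplier_coe_mul (b : B) (m : 𝓜(ℂ, B)) :
    (b : 𝓜(ℂ, B)) * m = (m.snd b : 𝓜(ℂ, B)) := by
  refine DoubleCentralizer.ext ℂ B _ _ (Prod.ext ?_ ?_)
  · ext x; simpa using (m.central b x).symm
  · ext x; simpa using multiplier_snd_mul m x b

theorem multiplier_mul_coe (b : B) (m : 𝓜(ℂ, B)) :
    m * (b : 𝓜(ℂ, B)) = (m.fst b : 𝓜(ℂ, B)) := by
  refine DoubleCentralizer.ext ℂ B _ _ (Prod.ext ?_ ?_)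
  · ext x; simpa using multiplier_fst_mul m b x
  · ext x; simpa using m.central x b

end Multipliers

section ApproximateUnit

open Filter Topology

theorem exists_approximate_unit (A : Type u) [NonUnitalCStarAlgebra A] :
    ∃ l : Filter A, l.IsApproximateUnit ∧ (∀ᶠ e in l, ‖e‖ ≤ 1) ∧ ∀ᶠ e in l, star e = e := by
  let _ := CStarAlgebra.spectralOrder A
  let _ := CStarAlgebra.spectralOrderedRing A
  have h := CStarAlgebra.increasingApproximateUnit (A := A)
  exact ⟨_, h.toIsApproximateUnit, h.eventually_norm, h.eventually_star_eq⟩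

variable {A : Type u} [NonUnitalCStarAlgebra A] {B : Type v} [NonUnitalCStarAlgebra B]

/-- The elements of `B` on which `ρ` of an approximate unit acts as an approximate unit. -/
def essentialSubspace (ρ : A →⋆ₙₐ[ℂ] B) (l : Filter A) : Submodule ℂ B where
  carrier := {b | Tendsto (fun e => ρ e * b) l (𝓝 b)}
  add_mem' {x y} hx hy := by
    have hx' : Tendsto (fun e => ρ e * x) l (𝓝 x) := hx
    have hy' : Tendsto (fun e => ρ e * y) l (𝓝 y) := hy
    simpa [mul_add] using hx'.add hy'
  zero_mem' := by simpa using tendsto_const_nhds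
  smul_mem' c x hx := by
    have hx' : Tendsto (fun e => ρ e * x) l (𝓝 x) := hx
    simpa [mul_smul_comm] using hx'.const_smul c

theorem mem_essentialSubspace {ρ : A →⋆ₙₐ[ℂ] B} {l : Filter A} {b : B} :
    b ∈ essentialSubspace ρ l ↔ Tendsto (fun e => ρ e * b) l (𝓝 b) := Iff.rfl

theorem isClosed_essentialSubspace (ρ : A →⋆ₙₐ[ℂ] B) {l : Filter A} (hl : ∀ᶠ e in l, ‖e‖ ≤ 1) :
    IsClosed (essentialSubspace ρ l : Set B) := by
  refine isClosed_of_closure_subset fun b hb => ?_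
  rw [SetLike.mem_coe, mem_essentialSubspace, Metric.tendsto_nhds]
  intro ε hε
  obtain ⟨b', hb', hd⟩ := Metric.mem_closure_iff.1 hb (ε / 3) (by positivity)
  have h1 := (Metric.tendsto_nhds.1 (mem_essentialSubspace.1 hb')) (ε / 3) (by positivity)
  filter_upwards [h1, hl] with e he1 he2
  have h2 : dist (ρ e * b) (ρ e * b') ≤ dist b b' := by
    rw [dist_eq_norm, dist_eq_norm, ← mul_sub]
    refine (norm_mul_le _ _).trans (mul_le_of_le_one_left (norm_nonneg _) ?_)
    exact (NonUnitalStarAlgHom.norm_apply_le ρ e).trans he2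
  calc dist (ρ e * b) b ≤ dist (ρ e * b) (ρ e * b') + dist (ρ e * b') b' + dist b' b :=
        dist_triangle4 _ _ _ _
    _ < ε := by rw [dist_comm b' b]; linarith

theorem mul_mem_essentialSubspace {ρ : A →⋆ₙₐ[ℂ] B} {l : Filter A} {x : B}
    (hx : x ∈ essentialSubspace ρ l) (y : B) : x * y ∈ essentialSubspace ρ l := by
  rw [mem_essentialSubspace] at hx ⊢
  simpa [mul_assoc] using hx.mul_const y

theorem map_mem_essentialSubspace (ρ : A →⋆ₙₐ[ℂ] B) {l : Filter A} (hl : l.IsApproximateUnit)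
    (a : A) : ρ a ∈ essentialSubspace ρ l := by
  have hc : Continuous ρ := AddMonoidHomClass.continuous_of_bound ρ 1
    (fun a => by simpa using NonUnitalStarAlgHom.norm_apply_le ρ a)
  rw [mem_essentialSubspace]
  simpa [Function.comp_def] using (hc.tendsto a).comp (hl.tendsto_mul_right a)

end ApproximateUnit

namespace ToeplitzRep

open Filter Topology

variable {A : Type u} [NonUnitalCStarAlgebra A] {E : ExelSystem A}
  {B : Type v} [NonUnitalCStarAlgebra B] (R : ToeplitzRep E B)

theorem mem_essentialSubspace {l : Filter A} (hl : l.IsApproximateUnit) (hl1 : ∀ᶠ e in l, ‖e‖ ≤ 1)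
    (b : B) : b ∈ essentialSubspace R.π l := by
  have h : (⊤ : Submodule ℂ B) ≤ essentialSubspace R.π l := by
    rw [← R.nondegenerate]
    refine Submodule.topologicalClosure_minimal _ (Submodule.span_le.2 ?_)
      (isClosed_essentialSubspace _ hl1)
    rintro _ ⟨a, b, rfl⟩
    exact mul_mem_essentialSubspace (map_mem_essentialSubspace _ hl a) b
  exact h Submodule.mem_top

/-- The element `π(a) V` of `B`. -/
noncomputable def πV (a : A) : B := R.V.snd (R.π a)

theorem coe_πV (a : A) : (R.πV a : 𝓜(ℂ, B)) = (R.π a : 𝓜(ℂ, B)) * R.V :=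
  (multiplier_coe_mul _ _).symm

theorem V_fst_π (a : A) : R.V.fst (R.π a) = R.πV (E.α a) := by
  apply multiplier_coe_injective
  rw [coe_πV, ← R.tc1, multiplier_mul_coe]

theorem π_mul_πV (a b : A) : R.π a * R.πV b = R.πV (a * b) := by
  rw [πV, πV, map_mul, multiplier_snd_mul]

theorem πV_mul_π (a b : A) : R.πV a * R.π b = R.πV (a * E.α b) := by
  rw [πV, R.V.central, V_fst_π, π_mul_πV]

theorem star_πV_mul_πV (a b : A) : star (R.πV a) * R.πV b = R.π (E.L (star a * b)) := by
  apply multiplier_coe_injective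
  rw [← R.tc2, multiplier_coe_mul_coe, multiplier_coe_star, coe_πV, coe_πV, map_mul, multiplier_coe_mul_coe, map_star, multiplier_coe_star,
    star_mul]
  simp only [mul_assoc]

theorem norm_πV_le (a : A) : ‖R.πV a‖ ≤ ‖ExelSystem.PreModule.of E a‖ := by
  refine le_of_sq_le_sq ?_ (norm_nonneg _)
  rw [ExelSystem.PreModule.norm_of_sq, sq, ← CStarRing.norm_star_mul_self, star_πV_mul_πV]
  exact NonUnitalStarAlgHom.norm_apply_le _ _

theorem norm_V_fst_le (b : B) : ‖R.V.fst b‖ ≤ √‖E.L‖ * ‖b‖ := by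
  obtain ⟨l, hl, hl1, -⟩ := exists_approximate_unit A
  have := hl.neBot
  refine le_of_sq_le_sq ?_ (by positivity)
  rw [mul_pow, Real.sq_sqrt (norm_nonneg _), sq, ← CStarRing.norm_star_mul_self]
  have h := (mem_essentialSubspace R hl hl1 (R.V.fst b))
  have h1 := (_root_.mem_essentialSubspace.1 h).const_mul (star (R.V.fst b))
  refine le_of_tendsto h1.norm ?_
  filter_upwards [hl1] with e he
  have h2 : star (R.V.fst b) * (R.π e * R.V.fst b) = star b * R.π (E.L e) * b := by
    apply multiplier_coe_injective
    rw [multiplier_coe_mul_coe, multiplier_coe_mul_coe, multiplier_coe_mul_coe,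
      multiplier_coe_mul_coe, multiplier_coe_star, multiplier_coe_star, ← R.tc2,
      ← multiplier_mul_coe, star_mul]
    simp only [mul_assoc]
  rw [h2]
  calc ‖star b * R.π (E.L e) * b‖ ≤ ‖star b‖ * ‖R.π (E.L e)‖ * ‖b‖ :=
        (norm_mul_le _ _).trans (by gcongr; exact norm_mul_le _ _)
    _ ≤ ‖b‖ * ‖E.L‖ * ‖b‖ := by
        rw [norm_star]
        gcongr
        exact (NonUnitalStarAlgHom.norm_apply_le _ _).trans
          ((E.L.le_opNorm e).trans (mul_le_of_le_one_right (norm_nonneg _) he))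
    _ = ‖E.L‖ * ‖b‖ ^ 2 := by ring

theorem norm_V_snd_le (b : B) : ‖R.V.snd b‖ ≤ √‖E.L‖ * ‖b‖ := by
  rcases eq_or_ne (R.V.snd b) 0 with h | h
  · rw [h, norm_zero]; positivity
  refine le_of_mul_le_mul_right ?_ (norm_pos_iff.2 h)
  calc ‖R.V.snd b‖ * ‖R.V.snd b‖ = ‖b * R.V.fst (star (R.V.snd b))‖ := by
        rw [← R.V.central, CStarRing.norm_self_mul_star]
    _ ≤ ‖b‖ * (√‖E.L‖ * ‖R.V.snd b‖) := by
        refine (norm_mul_le _ _).trans ?_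
        gcongr
        simpa using R.norm_V_fst_le (star (R.V.snd b))
    _ = √‖E.L‖ * ‖b‖ * ‖R.V.snd b‖ := by ring

end ToeplitzRep

namespace ExelSystem

open Filter Topology

variable {A : Type u} [NonUnitalCStarAlgebra A] (E : ExelSystem A)

/-- The collection of all Toeplitz-covariant representations of `(A, α, L)` in `C⋆`-algebras of the
universe of `A`. The universe is no restriction: for a representation `(π, V)` in `B`, the
`C⋆`-subalgebra `B₀` of `B` generated by `π(A) ∪ π(A)V` is multiplied into itself by `V` and `V*`,
so `(π, V)` is a representation in `B₀`, and `B₀` has no more elements than there are sequences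
in `A`. -/
structure RepIndex : Type (u + 1) where
  B : Type u
  [cstar : NonUnitalCStarAlgebra B]
  rep : ToeplitzRep E B

attribute [instance] RepIndex.cstar

/-- The `C⋆`-algebra of bounded families indexed by all Toeplitz-covariant representations. -/
abbrev RepProduct : Type (u + 1) := lp (fun R : E.RepIndex => R.B) ∞

/-- The homomorphism `a ↦ (π(a))`, indexed by all Toeplitz-covariant representations `(π, V)`. -/
noncomputable def prodπ : A →⋆ₙₐ[ℂ] E.RepProduct where
  toFun a := ⟨fun R => R.rep.π a, memℓp_infty ⟨‖a‖, by
    rintro _ ⟨R, rfl⟩; exact NonUnitalStarAlgHom.norm_apply_le _ _⟩⟩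
  map_smul' c a := by ext R; simp
  map_zero' := by ext R; simp
  map_add' a b := by ext R; exact map_add R.rep.π a b
  map_mul' a b := by ext R; simp
  map_star' a := by ext R; exact map_star R.rep.π a

/-- Left and right multiplication by the family `(V)`, indexed by all Toeplitz-covariant
representations `(π, V)`. -/
noncomputable def prodV : 𝓜(ℂ, E.RepProduct) where
  fst := LinearMap.mkContinuous
    { toFun := fun f => ⟨fun R => R.rep.V.fst (f R), memℓp_infty ⟨√‖E.L‖ * ‖f‖, by
        rintro _ ⟨R, rfl⟩
        exact (R.rep.norm_V_fst_le _).trans (by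
          gcongr; exact lp.norm_apply_le_norm ENNReal.top_ne_zero f R)⟩⟩
      map_add' := fun f g => by ext R; exact map_add R.rep.V.fst (f R) (g R)
      map_smul' := fun c f => by ext R; simp }
    √‖E.L‖ (fun f => lp.norm_le_of_forall_le (by positivity) fun R =>
        (R.rep.norm_V_fst_le _).trans (by
          gcongr; exact lp.norm_apply_le_norm ENNReal.top_ne_zero f R))
  snd := LinearMap.mkContinuous
    { toFun := fun f => ⟨fun R => R.rep.V.snd (f R), memℓp_infty ⟨√‖E.L‖ * ‖f‖, by
        rintro _ ⟨R, rfl⟩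
        exact (R.rep.norm_V_snd_le _).trans (by
          gcongr; exact lp.norm_apply_le_norm ENNReal.top_ne_zero f R)⟩⟩
      map_add' := fun f g => by ext R; exact map_add R.rep.V.snd (f R) (g R)
      map_smul' := fun c f => by ext R; simp }
    √‖E.L‖ (fun f => lp.norm_le_of_forall_le (by positivity) fun R =>
        (R.rep.norm_V_snd_le _).trans (by
          gcongr; exact lp.norm_apply_le_norm ENNReal.top_ne_zero f R))
  central f g := by ext R; exact R.rep.V.central (f R) (g R)

/-- The family `(π(a) V)`, indexed by all Toeplitz-covariant representations `(π, V)`. -/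
noncomputable def prodπV (a : A) : E.RepProduct := E.prodV.snd (E.prodπ a)

theorem prodπ_apply (a : A) (R : E.RepIndex) : E.prodπ a R = R.rep.π a := rfl

theorem prodπV_apply (a : A) (R : E.RepIndex) : E.prodπV a R = R.rep.πV a := rfl

theorem prodV_fst_apply (f : E.RepProduct) (R : E.RepIndex) :
    E.prodV.fst f R = R.rep.V.fst (f R) := rfl

theorem prodV_snd_apply (f : E.RepProduct) (R : E.RepIndex) :
    E.prodV.snd f R = R.rep.V.snd (f R) := rfl

/-- The Toeplitz crossed product as a `C⋆`-subalgebra of the product of all Toeplitz-covariant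
representations `(π, V)`: the `C⋆`-subalgebra generated by the families `(π(a))` and `(π(a) V)`
for `a ∈ A`. -/
noncomputable def toeplitzSubalgebra : NonUnitalStarSubalgebra ℂ E.RepProduct :=
  (NonUnitalStarAlgebra.adjoin ℂ (Set.range E.prodπ ∪ Set.range E.prodπV)).topologicalClosure

theorem isClosed_toeplitzSubalgebra : IsClosed (E.toeplitzSubalgebra : Set E.RepProduct) :=
  NonUnitalStarSubalgebra.isClosed_topologicalClosure _

/-- The Toeplitz crossed product `𝒯(A, α, L)`. -/
abbrev Toeplitz : Type (u + 1) := E.toeplitzSubalgebra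

noncomputable instance : NonUnitalCStarAlgebra E.Toeplitz :=
  NonUnitalStarSubalgebra.nonUnitalCStarAlgebra E.toeplitzSubalgebra
    (h_closed := E.isClosed_toeplitzSubalgebra)

theorem prodπ_mem (a : A) : E.prodπ a ∈ E.toeplitzSubalgebra :=
  NonUnitalStarSubalgebra.le_topologicalClosure _
    (NonUnitalStarAlgebra.subset_adjoin ℂ _ (Or.inl ⟨a, rfl⟩))

theorem prodπV_mem (a : A) : E.prodπV a ∈ E.toeplitzSubalgebra :=
  NonUnitalStarSubalgebra.le_topologicalClosure _
    (NonUnitalStarAlgebra.subset_adjoin ℂ _ (Or.inr ⟨a, rfl⟩))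

theorem prodπV_mul_prodπ (a b : A) : E.prodπV a * E.prodπ b = E.prodπV (a * E.α b) := by
  ext R; exact R.rep.πV_mul_π a b

theorem norm_prodπV_le (a : A) : ‖E.prodπV a‖ ≤ ‖PreModule.of E a‖ :=
  lp.norm_le_of_forall_le (norm_nonneg _) fun R => R.rep.norm_πV_le a

theorem prodπV_sub (a b : A) : E.prodπV (a - b) = E.prodπV a - E.prodπV b := by
  simp [prodπV]

theorem tendsto_of_sub_right {l : Filter A} (hl : l.IsApproximateUnit)
    (hl1 : ∀ᶠ e in l, ‖e‖ ≤ 1) (hs : ∀ᶠ e in l, star e = e) (a : A) :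
    Tendsto (fun e => ‖PreModule.of E (a - a * E.α e)‖) l (𝓝 0) := by
  have key : Tendsto (fun e => E.L (star a * a) - E.L (star a * a) * e
      - (e * E.L (star a * a) - e * (E.L (star a * a) * e))) l (𝓝 0) := by
    have h := (hl.tendsto_mul_left (E.L (star a * a))).const_sub (E.L (star a * a))
    rw [sub_self] at h
    have h' : Tendsto (fun e => e * (E.L (star a * a) - E.L (star a * a) * e)) l (𝓝 0) := by
      refine squeeze_zero_norm' ?_ (by simpa using h.norm)
      filter_upwards [hl1] with e he
      exact (norm_mul_le _ _).trans (mul_le_of_le_one_left (norm_nonneg _) he)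
    simpa [mul_sub] using h.sub h'
  have h2 := (Real.continuous_sqrt.tendsto _).comp key.norm
  rw [norm_zero, Real.sqrt_zero] at h2
  refine h2.congr' ?_
  filter_upwards [hs] with e he
  rw [Function.comp_apply, PreModule.norm_of]
  congr 2
  rw [star_sub, sub_mul, mul_sub, mul_sub, map_sub, map_sub, map_sub, E.L_mul_map, star_mul,
    ← map_star, he, mul_assoc, E.L_map_mul, mul_assoc, E.L_map_mul, E.L_mul_map]

theorem toeplitz_le_essentialSubspace {l : Filter A} (hl : l.IsApproximateUnit)
    (hl1 : ∀ᶠ e in l, ‖e‖ ≤ 1) (hs : ∀ᶠ e in l, star e = e) {t : E.RepProduct}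
    (ht : t ∈ E.toeplitzSubalgebra) : t ∈ essentialSubspace E.prodπ l := by
  have hcl := isClosed_essentialSubspace E.prodπ hl1
  suffices h : ((NonUnitalStarAlgebra.adjoin ℂ (Set.range E.prodπ ∪ Set.range E.prodπV) :
      NonUnitalStarSubalgebra ℂ E.RepProduct) : Set E.RepProduct) ⊆
      essentialSubspace E.prodπ l from closure_minimal h hcl ht
  intro x hx
  refine NonUnitalAlgebra.adjoin_induction
    (p := fun x _ => x ∈ essentialSubspace E.prodπ l) ?_ ?_ ?_ ?_ ?_ hx
  · rintro x ((⟨a, rfl⟩ | ⟨a, rfl⟩) | hx)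
    · exact map_mem_essentialSubspace _ hl a
    · rw [mem_essentialSubspace]
      have h := (E.prodV.snd.continuous.tendsto _).comp
        (mem_essentialSubspace.1 (map_mem_essentialSubspace E.prodπ hl a))
      exact h.congr fun e => multiplier_snd_mul _ _ _
    · rcases hx with ⟨a, ha⟩ | ⟨a, ha⟩
      · rw [← star_star x, ← ha, ← map_star]
        exact map_mem_essentialSubspace _ hl _
      · rw [mem_essentialSubspace, tendsto_iff_norm_sub_tendsto_zero]
        refine squeeze_zero' (Eventually.of_forall fun _ => norm_nonneg _) ?_
          (E.tendsto_of_sub_right hl hl1 hs a)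
        filter_upwards [hs] with e he
        rw [← norm_star, star_sub, star_mul, ← ha, ← map_star, he, prodπV_mul_prodπ,
          norm_sub_rev, ← prodπV_sub]
        exact E.norm_prodπV_le _
  · exact fun x y _ _ hx hy => add_mem hx hy
  · exact zero_mem _
  · exact fun x y _ _ hx _ => mul_mem_essentialSubspace hx y
  · exact fun c x _ hx => Submodule.smul_mem _ c hx

theorem prodV_fst_mem {t : E.RepProduct} (ht : t ∈ E.toeplitzSubalgebra) :
    E.prodV.fst t ∈ E.toeplitzSubalgebra := by
  obtain ⟨l, hl, hl1, hs⟩ := exists_approximate_unit A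
  have := hl.neBot
  have h := (E.prodV.fst.continuous.tendsto _).comp
    (mem_essentialSubspace.1 (E.toeplitz_le_essentialSubspace hl hl1 hs ht))
  refine E.isClosed_toeplitzSubalgebra.mem_of_tendsto h (Eventually.of_forall fun e => ?_)
  have h2 : E.prodV.fst (E.prodπ e * t) = E.prodπV (E.α e) * t := by
    rw [multiplier_fst_mul]
    congr 1
    ext R; exact R.rep.V_fst_π e
  rw [Function.comp_apply, h2]
  exact mul_mem (E.prodπV_mem _) ht

theorem prodV_snd_mem {t : E.RepProduct} (ht : t ∈ E.toeplitzSubalgebra) :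
    E.prodV.snd t ∈ E.toeplitzSubalgebra := by
  obtain ⟨l, hl, hl1, hs⟩ := exists_approximate_unit A
  have := hl.neBot
  have h1 := (mem_essentialSubspace.1
    (E.toeplitz_le_essentialSubspace hl hl1 hs (star_mem ht))).star
  have h := (E.prodV.snd.continuous.tendsto _).comp h1
  rw [star_star] at h
  refine E.isClosed_toeplitzSubalgebra.mem_of_tendsto h ?_
  filter_upwards [hs] with e he
  rw [Function.comp_apply, star_mul, star_star, ← map_star, he, multiplier_snd_mul]
  exact mul_mem ht (E.prodπV_mem _)

/-- The canonical homomorphism `i : A → 𝒯(A, α, L)`. -/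
noncomputable def i : A →⋆ₙₐ[ℂ] E.Toeplitz :=
  NonUnitalStarAlgHom.codRestrict E.prodπ E.toeplitzSubalgebra E.prodπ_mem

/-- The canonical multiplier `S ∈ M(𝒯(A, α, L))`: multiplication by the family `(V)`. -/
noncomputable def S : 𝓜(ℂ, E.Toeplitz) where
  fst := LinearMap.mkContinuous
    { toFun := fun t => ⟨E.prodV.fst t, E.prodV_fst_mem t.2⟩
      map_add' := fun s t => Subtype.ext (map_add E.prodV.fst (s : E.RepProduct) t)
      map_smul' := fun c t => Subtype.ext (map_smul E.prodV.fst c (t : E.RepProduct)) }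
    ‖E.prodV.fst‖ (fun t => E.prodV.fst.le_opNorm t)
  snd := LinearMap.mkContinuous
    { toFun := fun t => ⟨E.prodV.snd t, E.prodV_snd_mem t.2⟩
      map_add' := fun s t => Subtype.ext (map_add E.prodV.snd (s : E.RepProduct) t)
      map_smul' := fun c t => Subtype.ext (map_smul E.prodV.snd c (t : E.RepProduct)) }
    ‖E.prodV.snd‖ (fun t => E.prodV.snd.le_opNorm t)
  central s t := Subtype.ext (E.prodV.central (s : E.RepProduct) t)

theorem coe_i (a : A) : (E.i a : E.RepProduct) = E.prodπ a := rfl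

theorem coe_S_fst (t : E.Toeplitz) : (E.S.fst t : E.RepProduct) = E.prodV.fst t := rfl

theorem coe_S_snd (t : E.Toeplitz) : (E.S.snd t : E.RepProduct) = E.prodV.snd t := rfl

theorem tendsto_i_mul {l : Filter A} (hl : l.IsApproximateUnit)
    (hl1 : ∀ᶠ e in l, ‖e‖ ≤ 1) (hs : ∀ᶠ e in l, star e = e) (t : E.Toeplitz) :
    Tendsto (fun e => E.i e * t) l (𝓝 t) := by
  have h := mem_essentialSubspace.1 (E.toeplitz_le_essentialSubspace hl hl1 hs t.2)
  rw [tendsto_iff_norm_sub_tendsto_zero] at h ⊢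
  exact h

theorem nondegenerate_i : (Submodule.span ℂ
    {x : E.Toeplitz | ∃ (a : A) (b : E.Toeplitz), x = E.i a * b}).topologicalClosure = ⊤ := by
  obtain ⟨l, hl, hl1, hs⟩ := exists_approximate_unit A
  have := hl.neBot
  rw [Submodule.eq_top_iff']
  intro t
  exact (Submodule.isClosed_topologicalClosure _).mem_of_tendsto (E.tendsto_i_mul hl hl1 hs t)
    (Eventually.of_forall
      fun e => Submodule.le_topologicalClosure _ (Submodule.subset_span ⟨e, t, rfl⟩))

theorem tc1_S (a : A) :
    E.S * (E.i a : 𝓜(ℂ, E.Toeplitz)) = (E.i (E.α a) : 𝓜(ℂ, E.Toeplitz)) * E.S := by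
  rw [multiplier_mul_coe, multiplier_coe_mul]
  congr 1
  apply Subtype.ext
  ext R
  exact R.rep.V_fst_π a

theorem tc2_S (a : A) :
    star E.S * (E.i a : 𝓜(ℂ, E.Toeplitz)) * E.S = (E.i (E.L a) : 𝓜(ℂ, E.Toeplitz)) := by
  refine DoubleCentralizer.ext ℂ E.Toeplitz _ _ (Prod.ext ?_ ?_)
  · ext t R
    exact congrArg (fun m : 𝓜(ℂ, R.B) => m.fst ((t : E.RepProduct) R)) (R.rep.tc2 a)
  · ext t R
    exact congrArg (fun m : 𝓜(ℂ, R.B) => m.snd ((t : E.RepProduct) R)) (R.rep.tc2 a)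

/-- The pair `(i, S)` is a Toeplitz-covariant representation of `(A, α, L)` in `𝒯(A, α, L)`. -/
noncomputable def universalRep : ToeplitzRep E E.Toeplitz where
  π := E.i
  nondegenerate := E.nondegenerate_i
  V := E.S
  tc1 := E.tc1_S
  tc2 := E.tc2_S

/-- Universality of `(i, S)`: for every Toeplitz-covariant representation `(π, V)` of `(A, α, L)`
in `B` there is a unique homomorphism `ρ : 𝒯(A, α, L) → B` with `ρ ∘ i = π` whose extension to
multipliers sends `S` to `V`. -/
theorem existsUnique_lift {B : Type u} [NonUnitalCStarAlgebra B] (R : ToeplitzRep E B) :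
    ∃! ρ : E.Toeplitz →⋆ₙₐ[ℂ] B, (∀ a, ρ (E.i a) = R.π a) ∧
      (∀ t, ρ (E.S.fst t) = R.V.fst (ρ t)) ∧ ∀ t, ρ (E.S.snd t) = R.V.snd (ρ t) := by
  let R' : E.RepIndex := ⟨B, R⟩
  let ev : E.Toeplitz →⋆ₙₐ[ℂ] B :=
    { toFun := fun t => (t : E.RepProduct) R'
      map_smul' := fun _ _ => rfl
      map_zero' := rfl
      map_add' := fun _ _ => rfl
      map_mul' := fun _ _ => rfl
      map_star' := fun _ => rfl }
  refine ⟨ev, ⟨fun _ => rfl, fun _ => rfl, fun _ => rfl⟩, ?_⟩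
  rintro ρ ⟨h1, -, h2⟩
  have hcont : ∀ f : E.Toeplitz →⋆ₙₐ[ℂ] B, Continuous f := fun f =>
    AddMonoidHomClass.continuous_of_bound f 1
      (fun a => by simpa using NonUnitalStarAlgHom.norm_apply_le f a)
  have key : ∀ x (hx : x ∈ NonUnitalStarAlgebra.adjoin ℂ
      (Set.range E.prodπ ∪ Set.range E.prodπV)) (hx' : x ∈ E.toeplitzSubalgebra),
      ρ ⟨x, hx'⟩ = ev ⟨x, hx'⟩ := by
    intro x hx
    induction hx using NonUnitalStarAlgebra.adjoin_induction with
    | mem x hx =>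
      rintro hx'
      rcases hx with ⟨a, rfl⟩ | ⟨a, rfl⟩
      · exact h1 a
      · exact (h2 (E.i a)).trans (congrArg R.V.snd (h1 a))
    | add x y hx hy ihx ihy =>
      intro _
      have mx := NonUnitalStarSubalgebra.le_topologicalClosure _ hx
      have my := NonUnitalStarSubalgebra.le_topologicalClosure _ hy
      exact (map_add ρ ⟨x, mx⟩ ⟨y, my⟩).trans
        ((congrArg₂ (· + ·) (ihx mx) (ihy my)).trans (map_add ev ⟨x, mx⟩ ⟨y, my⟩).symm)
    | zero => intro _; exact (map_zero ρ).trans (map_zero ev).symm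
    | mul x y hx hy ihx ihy =>
      intro _
      have mx := NonUnitalStarSubalgebra.le_topologicalClosure _ hx
      have my := NonUnitalStarSubalgebra.le_topologicalClosure _ hy
      exact (map_mul ρ ⟨x, mx⟩ ⟨y, my⟩).trans
        ((congrArg₂ (· * ·) (ihx mx) (ihy my)).trans (map_mul ev ⟨x, mx⟩ ⟨y, my⟩).symm)
    | smul c x hx ihx =>
      intro _
      have mx := NonUnitalStarSubalgebra.le_topologicalClosure _ hx
      exact (map_smul ρ c ⟨x, mx⟩).trans
        ((congrArg (c • ·) (ihx mx)).trans (map_smul ev c ⟨x, mx⟩).symm)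
    | star x hx ihx =>
      intro _
      have mx := NonUnitalStarSubalgebra.le_topologicalClosure _ hx
      exact (map_star ρ ⟨x, mx⟩).trans
        ((congrArg star (ihx mx)).trans (map_star ev ⟨x, mx⟩).symm)
  ext t
  have hd : t ∈ closure {t : E.Toeplitz | (t : E.RepProduct) ∈ NonUnitalStarAlgebra.adjoin ℂ
      (Set.range E.prodπ ∪ Set.range E.prodπV)} := by
    rw [closure_subtype]
    refine closure_mono (fun x hx => ?_) t.2
    exact ⟨⟨x, NonUnitalStarSubalgebra.le_topologicalClosure _ hx⟩, hx, rfl⟩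
  exact closure_minimal (t := {t : E.Toeplitz | ρ t = ev t})
    (fun (y : E.Toeplitz) hy => key y hy y.2) (isClosed_eq (hcont ρ) (hcont ev)) hd

/-- The closed linear span of `i(A) S S* i(A)` in `𝒯(A, α, L)`. -/
noncomputable def spanSS : Submodule ℂ E.Toeplitz :=
  (Submodule.span ℂ {k : E.Toeplitz | ∃ a b : A,
    (k : 𝓜(ℂ, E.Toeplitz)) = E.i a * E.S * star E.S * E.i b}).topologicalClosure

/-- The pair `(i(a), k)` is a redundancy if `k` is in the closed linear span of `i(A) S S* i(A)`
and `i(a) i(b) S = k i(b) S` for all `b ∈ A`. -/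
def IsRedundancy (a : A) (k : E.Toeplitz) : Prop :=
  k ∈ E.spanSS ∧
    ∀ b : A, (E.i a : 𝓜(ℂ, E.Toeplitz)) * E.i b * E.S = (k : 𝓜(ℂ, E.Toeplitz)) * E.i b * E.S

/-- The ideal `I(A, α, L)`: the smallest closed two-sided ideal of `𝒯(A, α, L)` which contains
`i(a) - k` for every redundancy `(i(a), k)` with `a` in the closed linear span of `A α(A) A`. -/
noncomputable def redundancyIdeal : TwoSidedIdeal E.Toeplitz :=
  sInf {I | IsClosed (I : Set E.Toeplitz) ∧
    ∀ (a : A) (k : E.Toeplitz), a ∈ E.closureAαA → E.IsRedundancy a k → E.i a - k ∈ I}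

/-- The crossed product `A ⋊_{α,L} ℕ`, the quotient of `𝒯(A, α, L)` by the closed ideal
`I(A, α, L)`. -/
abbrev CrossedProduct : Type (u + 1) := E.redundancyIdeal.ringCon.Quotient

/-- The quotient map `Q : 𝒯(A, α, L) → A ⋊_{α,L} ℕ`. -/
noncomputable def Q : E.Toeplitz →ₙ+* E.CrossedProduct where
  toFun := E.redundancyIdeal.ringCon.toQuotient
  map_mul' _ _ := rfl
  map_zero' := rfl
  map_add' _ _ := rfl

end ExelSystem

/-! One direction is immediate. If `a ∈ K_α` and `L((ab)*ab) = 0` for all `b`, then every `i(ab)S`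
is zero, so `(i(a), 0)` is a redundancy and `i(a)` lies in the redundancy ideal. Since `i` is
injective, almost faithfulness is necessary.

For the converse, attach to each positive functional `f` on `A` a Fock representation on the Hilbert
sum of the GNS spaces of `f`, `f ∘ L`, `f ∘ L²`, and so on. Here `A` acts diagonally and `S` acts by
the shift `[a] ↦ [α(a)]`. The computation that carries the proof is `fockHom_redundancy`: for a
redundancy `(i(a), k)` the operator of `i(a) - k` is the GNS operator of `a` on summand zero and
vanishes on all others. It has two consequences.

If `f` vanishes on `K_α`, its Fock representation kills the redundancy ideal. Positive functionals
vanishing on `K_α` separate it from the elements outside, so `i(c)` in the ideal forces `c ∈ K_α`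
(`mem_Kα_of_i_mem`).

For arbitrary `f`, each element of the ideal has small norm on summands of large index, uniformly in
`f` (`vanishesAtInfinity_of_mem_redundancyIdeal`).

Let `L` be almost faithful on `K_α`, and let `c` and `c*` both be sent into the ideal. Such elements
form a closed subalgebra of `K_α` stable under `c ↦ L((cx)*cx)`. By induction on `n`, the
representations of `f ∘ L ^ n`, taken over all `f`, are jointly faithful on it
(`eq_zero_of_forall_iter`), hence jointly isometric. So `‖c‖` equals the supremum over `f` of the
norm of `c` on summand `n`, for every `n`, and this supremum becomes arbitrarily small. Therefore `c
= 0`.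

In the commutative case, almost faithful and faithful mean the same. -/

open scoped ComplexOrder

/-! ### Separation of closed ideals by positive functionals. -/

section PositiveFunctionals

variable {A : Type u} [NonUnitalCStarAlgebra A]

/-- A closed self-adjoint subalgebra contains approximate left units for each of its elements. -/
theorem exists_norm_sub_mul_lt {K : NonUnitalStarSubalgebra ℂ A} (hK : IsClosed (K : Set A))
    {k : A} (hk : k ∈ K) {ε : ℝ} (hε : 0 < ε) :
    ∃ e ∈ K, ‖e‖ ≤ 1 ∧ star e = e ∧ ‖k - e * k‖ < ε := by
  let _ : NonUnitalCStarAlgebra K :=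
    NonUnitalStarSubalgebra.nonUnitalCStarAlgebra K (h_closed := hK)
  obtain ⟨l, hl, hl1, hs⟩ := exists_approximate_unit K
  have := hl.neBot
  have h := (Metric.tendsto_nhds.1 (hl.tendsto_mul_right (⟨k, hk⟩ : K))) ε hε
  obtain ⟨e, ⟨he, he1⟩, he2⟩ := ((h.and hl1).and hs).exists
  refine ⟨e, e.2, he1, congrArg Subtype.val he2, ?_⟩
  rw [dist_eq_norm, norm_sub_rev] at he
  exact he

variable [PartialOrder A] [StarOrderedRing A]

/-- The convex cone `A₊ + K`. -/
def positiveConeAdd (K : NonUnitalStarSubalgebra ℂ A) : PointedCone ℝ A where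
  carrier := {x | ∃ p k : A, 0 ≤ p ∧ k ∈ K ∧ x = p + k}
  add_mem' := by
    rintro _ _ ⟨p, k, hp, hk, rfl⟩ ⟨p', k', hp', hk', rfl⟩
    exact ⟨p + p', k + k', add_nonneg hp hp', add_mem hk hk', by abel⟩
  zero_mem' := ⟨0, 0, le_rfl, zero_mem _, by simp⟩
  smul_mem' := by
    rintro ⟨c, hc⟩ _ ⟨p, k, hp, hk, rfl⟩
    refine ⟨c • p, c • k, smul_nonneg hc hp, ?_, smul_add c p k⟩
    rw [← Complex.coe_smul]
    exact SMulMemClass.smul_mem _ hk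

/-- If `-c*c` were close to `p + k` with `p ≥ 0` and `k ∈ K`, compress by `1 - e` for an approximate
unit `e` of `K`. This makes `k` small, so `(1 - e)(c*c + p)(1 - e)` is small. It dominates `(1 -
e)c*c(1 - e)`, so `c` is close to `ce ∈ K`. -/
theorem neg_star_mul_self_notMem_closure {K : NonUnitalStarSubalgebra ℂ A}
    (hK : IsClosed (K : Set A)) (hl : ∀ a, ∀ x ∈ K, a * x ∈ K) {c : A} (hc : c ∉ K) :
    -(star c * c) ∉ closure (positiveConeAdd K : Set A) := by
  intro h
  apply hc
  rw [← SetLike.mem_coe, ← hK.closure_eq, Metric.mem_closure_iff]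
  intro ε hε
  -- Two-sided compression by `1 - e` costs a factor of at most 4, giving `ε²/2`. The compressed `k`
  -- costs only a factor 2 on `k - ek`, giving `ε²/4`. The total stays below `ε²`.
  obtain ⟨_, ⟨p, k, hp, hk, rfl⟩, hd⟩ := Metric.mem_closure_iff.1 h (ε ^ 2 / 8) (by positivity)
  obtain ⟨e, heK, he1, hes, hke⟩ := exists_norm_sub_mul_lt hK hk (ε := ε ^ 2 / 8) (by positivity)
  refine ⟨c * e, hl c e heK, ?_⟩
  obtain ⟨d, rfl⟩ := CStarAlgebra.nonneg_iff_eq_star_mul_self.1 hp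
  let Φ : A → A := fun x => (x - e * x) - (x - e * x) * e
  have hΦ : ∀ x, Φ (star x * x) = star (x - x * e) * (x - x * e) := by
    intro x
    simp only [Φ, star_sub, star_mul, hes, sub_mul, mul_sub, mul_assoc]
  have hΦadd : ∀ x y, Φ (x + y) = Φ x + Φ y := by
    intro x y
    simp only [Φ, mul_add, sub_mul, add_mul]
    abel
  have hb : ∀ x : A, ‖x - x * e‖ ≤ 2 * ‖x‖ := by
    intro x
    have h1 := norm_sub_le x (x * e)
    have h2 := (norm_mul_le x e).trans (mul_le_of_le_one_right (norm_nonneg x) he1)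
    linarith
  have hb' : ∀ x : A, ‖x - e * x‖ ≤ 2 * ‖x‖ := by
    intro x
    have h1 := norm_sub_le x (e * x)
    have h2 := (norm_mul_le e x).trans (mul_le_of_le_one_left (norm_nonneg x) he1)
    linarith
  have h1 : ‖Φ (star c * c)‖ ≤ ‖Φ (star c * c + star d * d)‖ := by
    refine CStarAlgebra.norm_le_norm_of_nonneg_of_le ?_ ?_
    · rw [hΦ]; exact star_mul_self_nonneg _
    · rw [hΦadd, hΦ d]; exact le_add_of_nonneg_right (star_mul_self_nonneg _)
  have h2 : ‖Φ (star c * c + star d * d + k)‖ < ε ^ 2 / 2 := by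
    have h3 : ‖star c * c + star d * d + k‖ < ε ^ 2 / 8 := by
      have h0 : star c * c + star d * d + k = -(-(star c * c) - (star d * d + k)) := by abel
      rw [dist_eq_norm] at hd
      rwa [h0, norm_neg]
    have h4 := (hb _).trans (mul_le_mul_of_nonneg_left (hb' (star c * c + star d * d + k))
      (by norm_num : (0 : ℝ) ≤ 2))
    exact h4.trans_lt (by linarith)
  have h3 : ‖Φ k‖ < ε ^ 2 / 4 := (hb _).trans_lt (by linarith)
  have h4 : Φ (star c * c + star d * d) = Φ (star c * c + star d * d + k) - Φ k := by
    rw [hΦadd _ k, add_sub_cancel_right]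
  have h5 : ‖c - c * e‖ ^ 2 < ε ^ 2 := by
    rw [sq, ← CStarRing.norm_star_mul_self, ← hΦ]
    refine h1.trans_lt ?_
    rw [h4]
    have := norm_sub_le (Φ (star c * c + star d * d + k)) (Φ k)
    linarith [sq_nonneg ε]
  rw [dist_eq_norm]
  exact lt_of_pow_lt_pow_left₀ 2 hε.le h5

/-- A closed self-adjoint left ideal is separated from each element outside by a positive
functional. -/
theorem exists_positive_functional {K : NonUnitalStarSubalgebra ℂ A}
    (hK : IsClosed (K : Set A)) (hl : ∀ a, ∀ x ∈ K, a * x ∈ K) {c : A} (hc : c ∉ K) :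
    ∃ f : A →ₚ[ℂ] ℂ, (∀ x ∈ K, f x = 0) ∧ f (star c * c) ≠ 0 := by
  -- A functional nonnegative on the closure of `A₊ + K` is positive, and it vanishes on `K` because
  -- `K = -K`.
  let C : ProperCone ℝ A := Submodule.closure (positiveConeAdd K)
  have hC : -(star c * c) ∉ C := neg_star_mul_self_notMem_closure hK hl hc
  obtain ⟨f, hf, hfc⟩ := C.hyperplane_separation_point hC
  have hpos : ∀ p : A, 0 ≤ p → 0 ≤ f p := fun p hp =>
    hf p (subset_closure ⟨p, 0, hp, zero_mem _, by simp⟩)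
  have hker : ∀ k ∈ K, f k = 0 := by
    intro k hk
    have h1 := hf k (subset_closure ⟨0, k, le_rfl, hk, by simp⟩)
    have h2 := hf (-k) (subset_closure ⟨0, -k, le_rfl, neg_mem hk, by simp⟩)
    rw [map_neg] at h2
    linarith
  -- The separating functional is only real linear and unconstrained off the self-adjoint part.
  -- Symmetrizing removes the contribution of `i p` for `p ≥ 0`, so the complexification is
  -- positive, with value `2 f p` at `p`.
  let F : Module.Dual ℝ A :=
    { toFun := fun x => f (x + star x)
      map_add' := fun x y => by
        rw [← map_add, star_add]
        congr 1
        abel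
      map_smul' := fun r x => by simp [star_smul, mul_add] }
  have hF : ∀ x, F x = f (x + star x) := fun _ => rfl
  have hFI : ∀ p : A, 0 ≤ p → F (Complex.I • p) = 0 := by
    intro p hp
    rw [hF, star_smul, (IsSelfAdjoint.of_nonneg hp).star_eq]
    simp
  have hg : ∀ p : A, 0 ≤ p → (F.extendRCLike p : ℂ) = (2 * f p : ℝ) := by
    intro p hp
    rw [Module.Dual.extendRCLike_apply]
    have : (RCLike.I : ℂ) = Complex.I := rfl
    rw [this, hFI p hp, hF, (IsSelfAdjoint.of_nonneg hp).star_eq, ← two_smul ℝ, map_smul]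
    simp
  refine ⟨PositiveLinearMap.mk₀ (F.extendRCLike : Module.Dual ℂ A) ?_, ?_, ?_⟩
  · intro p hp
    rw [hg p hp]
    exact_mod_cast mul_nonneg zero_le_two (hpos p hp)
  · intro x hx
    have h1 : ∀ y ∈ K, F y = 0 := fun y hy => hker _ (add_mem hy (star_mem hy))
    change (F.extendRCLike x : ℂ) = 0
    rw [Module.Dual.extendRCLike_apply, h1 x hx, h1 _ (SMulMemClass.smul_mem _ hx)]
    simp
  · change (F.extendRCLike (star c * c) : ℂ) ≠ 0
    rw [hg _ (star_mul_self_nonneg c)]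
    rw [map_neg] at hfc
    have : (2 * f (star c * c) : ℝ) ≠ 0 := by linarith
    exact_mod_cast this

theorem eq_zero_of_forall_positive_functional {c : A}
    (h : ∀ f : A →ₚ[ℂ] ℂ, f (star c * c) = 0) : c = 0 := by
  by_contra hc
  obtain ⟨f, -, hf⟩ := exists_positive_functional (K := (⊥ : NonUnitalStarSubalgebra ℂ A))
    (by simp) (by simp [NonUnitalStarAlgebra.mem_bot]) (c := c)
    (by simpa [NonUnitalStarAlgebra.mem_bot] using hc)
  exact hf (h f)

end PositiveFunctionals

namespace ExelSystem

variable {A : Type u} [NonUnitalCStarAlgebra A] (E : ExelSystem A)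

/-! ### Adjoints and compact operators on `M_L` -/

section HilbertModule

variable {E}

theorem M_induction {p : E.M → Prop} (hp : IsClosed {x | p x}) (h : ∀ a, p (E.q a)) (x : E.M) :
    p x :=
  UniformSpace.Completion.induction_on x hp fun a => h ((PreModule.of E).symm a)

theorem M_induction₂ {p : E.M → E.M → Prop} (hp : IsClosed {x : E.M × E.M | p x.1 x.2})
    (h : ∀ a b, p (E.q a) (E.q b)) (x y : E.M) : p x y :=
  UniformSpace.Completion.induction_on₂ x y hp
    fun a b => h ((PreModule.of E).symm a) ((PreModule.of E).symm b)

theorem norm_q (x : A) : ‖E.q x‖ = ‖PreModule.of E x‖ :=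
  UniformSpace.Completion.norm_coe _

theorem norm_q_sq (x : A) : ‖E.q x‖ ^ 2 = ‖E.L (star x * x)‖ := by
  rw [norm_q, PreModule.norm_of_sq]

theorem norm_inner_self (x : E.M) : ‖E.inner x x‖ = ‖x‖ ^ 2 := by
  refine M_induction (p := fun x => ‖E.inner x x‖ = ‖x‖ ^ 2)
    (isClosed_eq (by fun_prop) (by fun_prop)) (fun a => ?_) x
  rw [inner_q_q, norm_q_sq]

theorem norm_inner_le (x y : E.M) : ‖E.inner x y‖ ≤ ‖x‖ * ‖y‖ := by
  refine M_induction₂ (p := fun x y => ‖E.inner x y‖ ≤ ‖x‖ * ‖y‖)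
    (isClosed_le (by fun_prop) (by fun_prop)) (fun a b => ?_) x y
  rw [inner_q_q, norm_q, norm_q]
  exact PreModule.norm_L_le_mul E a b

theorem star_inner (x y : E.M) : star (E.inner x y) = E.inner y x := by
  refine M_induction₂ (p := fun x y => star (E.inner x y) = E.inner y x)
    (isClosed_eq (by fun_prop) (by fun_prop)) (fun a b => ?_) x y
  rw [inner_q_q, inner_q_q, E.star_L]

theorem inner_right (x y : E.M) (a : A) : E.inner x (E.right y a) = E.inner x y * a := by
  refine M_induction₂ (p := fun x y => E.inner x (E.right y a) = E.inner x y * a)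
    (isClosed_eq (by fun_prop) (by fun_prop)) (fun b c => ?_) x y
  rw [right_q, inner_q_q, inner_q_q, E.L_mul_map]

theorem right_inner (x y : E.M) (a : A) : E.inner (E.right x a) y = star a * E.inner x y := by
  rw [← star_inner, inner_right, star_mul, star_inner]

theorem inner_φ (a : A) (x y : E.M) : E.inner (E.φ a x) y = E.inner x (E.φ (star a) y) := by
  refine M_induction₂ (p := fun x y => E.inner (E.φ a x) y = E.inner x (E.φ (star a) y))
    (isClosed_eq (by fun_prop) (by fun_prop)) (fun b c => ?_) x y
  rw [φ_q, φ_q, inner_q_q, inner_q_q, star_mul, mul_assoc]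

theorem φ_right (a : A) (x : E.M) (b : A) : E.φ a (E.right x b) = E.right (E.φ a x) b := by
  refine M_induction (p := fun x => E.φ a (E.right x b) = E.right (E.φ a x) b)
    (isClosed_eq (by fun_prop) (by fun_prop)) (fun c => ?_) x
  rw [right_q, φ_q, φ_q, right_q, mul_assoc]

theorem φ_mul (a b : A) : E.φ (a * b) = (E.φ a).comp (E.φ b) := by
  ext x
  refine M_induction (p := fun x => E.φ (a * b) x = (E.φ a).comp (E.φ b) x)
    (isClosed_eq (by fun_prop) (by fun_prop)) (fun c => ?_) x
  rw [ContinuousLinearMap.comp_apply, φ_q, φ_q, φ_q, mul_assoc]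

/-- `T'` is an adjoint of the operator `T` on `M_L`. -/
def IsAdjoint (T T' : E.M →L[ℂ] E.M) : Prop := ∀ x y, E.inner (T x) y = E.inner x (T' y)

/-- This lets adjoints pass through norm approximation without forming the `C⋆`-algebra of
adjointable operators. -/
theorem IsAdjoint.norm_le {T T' : E.M →L[ℂ] E.M} (h : IsAdjoint T T') : ‖T'‖ ≤ ‖T‖ := by
  refine T'.opNorm_le_bound (norm_nonneg _) fun y => ?_
  rcases eq_or_ne (‖T' y‖) 0 with h0 | h0
  · rw [h0]; positivity
  refine le_of_mul_le_mul_right ?_ ((norm_nonneg _).lt_of_ne' h0)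
  calc ‖T' y‖ * ‖T' y‖ = ‖E.inner (T (T' y)) y‖ := by rw [h, norm_inner_self, sq]
    _ ≤ ‖T‖ * ‖T' y‖ * ‖y‖ := (norm_inner_le _ _).trans (by gcongr; exact T.le_opNorm _)
    _ = ‖T‖ * ‖y‖ * ‖T' y‖ := by ring

theorem isAdjoint_Θ (x y : E.M) : IsAdjoint (E.Θ x y) (E.Θ y x) := by
  intro z w
  simp only [Θ, ContinuousLinearMap.comp_apply]
  rw [right_inner, inner_right, star_inner]

theorem exists_isAdjoint_of_mem_span {T : E.M →L[ℂ] E.M}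
    (hT : T ∈ Submodule.span ℂ {T | ∃ x y : E.M, T = E.Θ x y}) :
    ∃ T' ∈ Submodule.span ℂ {T | ∃ x y : E.M, T = E.Θ x y}, IsAdjoint T T' := by
  induction hT using Submodule.span_induction with
  | mem T hT =>
    obtain ⟨x, y, rfl⟩ := hT
    exact ⟨E.Θ y x, Submodule.subset_span ⟨y, x, rfl⟩, isAdjoint_Θ x y⟩
  | zero => exact ⟨0, zero_mem _, fun x y => by simp⟩
  | add S T _ _ hS hT =>
    obtain ⟨S', hS', hS⟩ := hS
    obtain ⟨T', hT', hT⟩ := hT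
    exact ⟨S' + T', add_mem hS' hT', fun x y => by simp [hS x y, hT x y]⟩
  | smul c T _ hT =>
    obtain ⟨T', hT', hT⟩ := hT
    exact ⟨star c • T', Submodule.smul_mem _ _ hT', fun x y => by simp [hT x y]⟩

theorem star_mem_J {a : A} (ha : a ∈ E.J) : star a ∈ E.J := by
  change E.φ (star a) ∈ closure _
  rw [Metric.mem_closure_iff]
  intro ε hε
  obtain ⟨T, hT, hd⟩ := Metric.mem_closure_iff.1 (show E.φ a ∈ closure _ from ha) ε hε
  obtain ⟨T', hT', h⟩ := exists_isAdjoint_of_mem_span hT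
  refine ⟨T', hT', ?_⟩
  rw [dist_eq_norm] at hd ⊢
  -- The difference `φ(a*) - T'` is an adjoint of `φ(a) - T`, so it is no larger in norm.
  have hs : IsAdjoint (E.φ a - T) (E.φ (star a) - T') := fun x y => by
    simp [h x y, inner_φ]
  exact hs.norm_le.trans_lt hd

theorem mul_mem_J (b : A) {a : A} (ha : a ∈ E.J) : b * a ∈ E.J := by
  change E.φ (b * a) ∈ E.compactOperators
  have hc : Continuous fun T : E.M →L[ℂ] E.M => (E.φ b).comp T := by fun_prop
  rw [φ_mul]
  refine map_mem_closure hc (show E.φ a ∈ closure _ from ha) fun T hT => ?_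
  rw [SetLike.mem_coe] at hT ⊢
  induction hT using Submodule.span_induction with
  | mem T hT =>
    obtain ⟨x, y, rfl⟩ := hT
    refine Submodule.subset_span ⟨E.φ b x, y, ?_⟩
    ext z
    simp [Θ, φ_right]
  | zero => simp
  | add S T _ _ hS hT => rw [ContinuousLinearMap.comp_add]; exact add_mem hS hT
  | smul c T _ hT => rw [ContinuousLinearMap.comp_smul]; exact Submodule.smul_mem _ _ hT

end HilbertModule

theorem isClosed_J : IsClosed (E.J : Set A) :=
  (Submodule.isClosed_topologicalClosure _).preimage E.φ.continuous

variable {E}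

theorem star_mem_closureAαA {a : A} (ha : a ∈ E.closureAαA) : star a ∈ E.closureAαA := by
  refine map_mem_closure continuous_star ha fun x hx => ?_
  rw [SetLike.mem_coe] at hx ⊢
  induction hx using Submodule.span_induction with
  | mem x hx =>
    obtain ⟨a, b, c, rfl⟩ := hx
    exact Submodule.subset_span ⟨star c, star b, star a, by simp [mul_assoc, map_star]⟩
  | zero => simp
  | add x y _ _ hx hy => rw [star_add]; exact add_mem hx hy
  | smul c x _ hx => rw [star_smul]; exact Submodule.smul_mem _ _ hx

theorem mul_mem_closureAαA (d : A) {a : A} (ha : a ∈ E.closureAαA) : d * a ∈ E.closureAαA := by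
  refine map_mem_closure (continuous_const_mul d) ha fun x hx => ?_
  rw [SetLike.mem_coe] at hx ⊢
  induction hx using Submodule.span_induction with
  | mem x hx =>
    obtain ⟨a, b, c, rfl⟩ := hx
    exact Submodule.subset_span ⟨d * a, b, c, by simp [mul_assoc]⟩
  | zero => simp
  | add x y _ _ hx hy => rw [mul_add]; exact add_mem hx hy
  | smul c x _ hx => rw [mul_smul_comm]; exact Submodule.smul_mem _ _ hx

theorem star_mem_Kα {a : A} (ha : a ∈ E.Kα) : star a ∈ E.Kα :=
  ⟨star_mem_closureAαA ha.1, star_mem_J ha.2⟩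

theorem mul_mem_Kα (d : A) {a : A} (ha : a ∈ E.Kα) : d * a ∈ E.Kα :=
  ⟨mul_mem_closureAαA d ha.1, mul_mem_J d ha.2⟩

variable (E)

theorem isClosed_Kα : IsClosed (E.Kα : Set A) :=
  (Submodule.isClosed_topologicalClosure _).inter E.isClosed_J

/-- The ideal `K_α` as a self-adjoint subalgebra. -/
noncomputable def KαSubalgebra : NonUnitalStarSubalgebra ℂ A where
  __ := E.Kα
  mul_mem' _ hb := mul_mem_Kα _ hb
  star_mem' ha := star_mem_Kα ha

theorem mul_mem_Kα_right {a : A} (ha : a ∈ E.Kα) (d : A) : a * d ∈ E.Kα := by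
  rw [← star_star (a * d), star_mul]
  exact star_mem_Kα (mul_mem_Kα _ (star_mem_Kα ha))

end ExelSystem

/-! ### Covariant pairs with possibly degenerate `π`, and their lifts to the Toeplitz algebra. -/

section EssentialAlgebra

open Filter Topology

variable {A : Type u} [NonUnitalCStarAlgebra A] {C : Type v} [NonUnitalCStarAlgebra C]

/-- The hereditary subalgebra of those `b` such that `ρ` of an approximate unit acts as an
approximate unit on `b` and `star b`. -/
def essentialAlgebra (ρ : A →⋆ₙₐ[ℂ] C) (l : Filter A) : NonUnitalStarSubalgebra ℂ C where
  carrier := {b | b ∈ essentialSubspace ρ l ∧ star b ∈ essentialSubspace ρ l}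
  add_mem' hx hy := ⟨add_mem hx.1 hy.1, by rw [star_add]; exact add_mem hx.2 hy.2⟩
  zero_mem' := ⟨zero_mem _, by rw [star_zero]; exact zero_mem _⟩
  mul_mem' hx hy := ⟨mul_mem_essentialSubspace hx.1 _, by
    rw [star_mul]; exact mul_mem_essentialSubspace hy.2 _⟩
  smul_mem' c x hx := ⟨Submodule.smul_mem _ c hx.1, by
    rw [star_smul]; exact Submodule.smul_mem _ _ hx.2⟩
  star_mem' hx := ⟨hx.2, by rw [star_star]; exact hx.1⟩

theorem isClosed_essentialAlgebra (ρ : A →⋆ₙₐ[ℂ] C) {l : Filter A} (hl1 : ∀ᶠ e in l, ‖e‖ ≤ 1) :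
    IsClosed (essentialAlgebra ρ l : Set C) :=
  (isClosed_essentialSubspace ρ hl1).inter
    ((isClosed_essentialSubspace ρ hl1).preimage continuous_star)

theorem map_mem_essentialAlgebra (ρ : A →⋆ₙₐ[ℂ] C) {l : Filter A} (hl : l.IsApproximateUnit)
    (a : A) : ρ a ∈ essentialAlgebra ρ l :=
  ⟨map_mem_essentialSubspace ρ hl a, by rw [← map_star]; exact map_mem_essentialSubspace ρ hl _⟩

end EssentialAlgebra

namespace ExelSystem

open Filter Topology

variable {A : Type u} [NonUnitalCStarAlgebra A] (E : ExelSystem A)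

/-- A Toeplitz-covariant pair in a unital `C⋆`-algebra, with `π` possibly degenerate. -/
structure CovariantPair (C : Type v) [CStarAlgebra C] where
  π : A →⋆ₙₐ[ℂ] C
  V : C
  V_mul_π : ∀ a, V * π a = π (E.α a) * V
  star_V_mul : ∀ a, star V * π a * V = π (E.L a)

namespace CovariantPair

variable {E} {C : Type v} [CStarAlgebra C] (P : E.CovariantPair C)

theorem π_mul_star_V (a : A) : P.π a * star P.V = star P.V * P.π (E.α a) := by
  have := congrArg star (P.V_mul_π (star a))
  simpa [map_star] using this

theorem norm_π_mul_V_le (a : A) : ‖P.π a * P.V‖ ≤ ‖PreModule.of E a‖ := by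
  refine le_of_sq_le_sq ?_ (norm_nonneg _)
  rw [PreModule.norm_of_sq, sq, ← CStarRing.norm_star_mul_self, star_mul, ← map_star, mul_assoc,
    ← mul_assoc (P.π _), ← map_mul, ← mul_assoc, star_V_mul]
  exact NonUnitalStarAlgHom.norm_apply_le _ _

variable {l : Filter A}

theorem V_mul_mem (hl : l.IsApproximateUnit) (hl1 : ∀ᶠ e in l, ‖e‖ ≤ 1) {b : C}
    (hb : b ∈ essentialSubspace P.π l) : P.V * b ∈ essentialSubspace P.π l := by
  have := hl.neBot
  refine (isClosed_essentialSubspace P.π hl1).mem_of_tendsto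
    ((mem_essentialSubspace.1 hb).const_mul P.V) (Eventually.of_forall fun e => ?_)
  rw [← mul_assoc, P.V_mul_π, mul_assoc]
  exact mul_mem_essentialSubspace (map_mem_essentialSubspace _ hl _) _

/-- Covariance gives `π(e)V*π(a) = V*π(α(e)a)`. Although `α(e)a` need not tend to `a` in `A`, the
element `a* - a*α(e)` tends to zero in the seminorm of `A_L`, which dominates `‖π(·)V‖`. -/
theorem star_V_mul_π_mem (hl : l.IsApproximateUnit) (hl1 : ∀ᶠ e in l, ‖e‖ ≤ 1)
    (hs : ∀ᶠ e in l, star e = e) (a : A) : star P.V * P.π a ∈ essentialSubspace P.π l := by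
  rw [mem_essentialSubspace, tendsto_iff_norm_sub_tendsto_zero]
  refine squeeze_zero' (Eventually.of_forall fun _ => norm_nonneg _) ?_
    (E.tendsto_of_sub_right hl hl1 hs (star a))
  filter_upwards [hs] with e he
  refine le_trans (le_of_eq ?_) (P.norm_π_mul_V_le _)
  rw [← mul_assoc, π_mul_star_V, mul_assoc, ← map_mul, ← mul_sub, ← map_sub, ← norm_star,
    star_mul, star_star, ← map_star, star_sub, star_mul, ← map_star, he, ← neg_sub, map_neg,
    neg_mul, norm_neg]

theorem star_V_mul_mem (hl : l.IsApproximateUnit) (hl1 : ∀ᶠ e in l, ‖e‖ ≤ 1)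
    (hs : ∀ᶠ e in l, star e = e) {b : C} (hb : b ∈ essentialSubspace P.π l) :
    star P.V * b ∈ essentialSubspace P.π l := by
  have := hl.neBot
  refine (isClosed_essentialSubspace P.π hl1).mem_of_tendsto
    ((mem_essentialSubspace.1 hb).const_mul (star P.V)) (Eventually.of_forall fun e => ?_)
  rw [← mul_assoc]
  exact mul_mem_essentialSubspace (P.star_V_mul_π_mem hl hl1 hs _) _

theorem mul_V_mem (hl : l.IsApproximateUnit) (hl1 : ∀ᶠ e in l, ‖e‖ ≤ 1)
    (hs : ∀ᶠ e in l, star e = e) {b : C} (hb : b ∈ essentialAlgebra P.π l) :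
    b * P.V ∈ essentialAlgebra P.π l := by
  refine ⟨mul_mem_essentialSubspace hb.1 _, ?_⟩
  rw [star_mul]
  exact P.star_V_mul_mem hl hl1 hs hb.2

theorem V_mul_mem' (hl : l.IsApproximateUnit) (hl1 : ∀ᶠ e in l, ‖e‖ ≤ 1) {b : C}
    (hb : b ∈ essentialAlgebra P.π l) : P.V * b ∈ essentialAlgebra P.π l := by
  refine ⟨P.V_mul_mem hl hl1 hb.1, ?_⟩
  rw [star_mul]
  exact mul_mem_essentialSubspace hb.2 _

/-- A covariant pair gives a Toeplitz-covariant representation in the `C⋆`-algebra on which its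
approximate unit acts nondegenerately. -/
theorem exists_rep {C : Type u} [CStarAlgebra C] (P : E.CovariantPair C) :
    ∃ (R : E.RepIndex) (ι : R.B →⋆ₙₐ[ℂ] C), (∀ a, ι (R.rep.π a) = P.π a) ∧
      (∀ b, ι (R.rep.V.fst b) = P.V * ι b) ∧ ∀ b, ι (R.rep.V.snd b) = ι b * P.V := by
  obtain ⟨l, hl, hl1, hs⟩ := exists_approximate_unit A
  have := hl.neBot
  let B := essentialAlgebra P.π l
  have hB : IsClosed (B : Set C) := isClosed_essentialAlgebra P.π hl1
  let inst : NonUnitalCStarAlgebra B :=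
    NonUnitalStarSubalgebra.nonUnitalCStarAlgebra B (h_closed := hB)
  let W : 𝓜(ℂ, B) :=
    { fst := LinearMap.mkContinuous
        { toFun := fun b => ⟨P.V * b, P.V_mul_mem' hl hl1 b.2⟩
          map_add' := fun x y => Subtype.ext (mul_add P.V (x : C) y)
          map_smul' := fun c x => Subtype.ext (mul_smul_comm c P.V (x : C)) }
        ‖P.V‖ (fun b => norm_mul_le P.V (b : C))
      snd := LinearMap.mkContinuous
        { toFun := fun b => ⟨b * P.V, P.mul_V_mem hl hl1 hs b.2⟩
          map_add' := fun x y => Subtype.ext (add_mul (x : C) y P.V)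
          map_smul' := fun c x => Subtype.ext (smul_mul_assoc c (x : C) P.V) }
        ‖P.V‖ (fun b => (norm_mul_le (b : C) P.V).trans_eq (mul_comm _ _))
      central := fun x y => Subtype.ext (mul_assoc (x : C) P.V y) }
  let π' : A →⋆ₙₐ[ℂ] B :=
    NonUnitalStarAlgHom.codRestrict P.π B (map_mem_essentialAlgebra P.π hl)
  refine ⟨⟨B, ⟨π', ?_, W, ?_, ?_⟩⟩, NonUnitalStarSubalgebraClass.subtype B, fun a => rfl,
    fun b => rfl, fun b => rfl⟩
  · rw [Submodule.eq_top_iff']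
    intro b
    have h : Tendsto (fun e => π' e * b) l (𝓝 b) := by
      rw [tendsto_iff_norm_sub_tendsto_zero]
      have h1 := tendsto_iff_norm_sub_tendsto_zero.1
        ((mem_essentialSubspace (ρ := P.π)).1 b.2.1)
      exact h1
    exact (Submodule.isClosed_topologicalClosure _).mem_of_tendsto h
      (Eventually.of_forall
        fun e => Submodule.le_topologicalClosure _ (Submodule.subset_span ⟨e, b, rfl⟩))
  · intro a
    rw [multiplier_mul_coe, multiplier_coe_mul]
    congr 1
    exact Subtype.ext (P.V_mul_π a)
  · intro a
    refine DoubleCentralizer.ext ℂ B _ _ (Prod.ext ?_ ?_)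
    · ext b
      change star (star (P.π a * (P.V * (b : C))) * P.V) = P.π (E.L a) * (b : C)
      rw [star_mul, star_star, ← P.star_V_mul]
      simp only [mul_assoc]
    · ext b
      change star (P.V * star (b : C)) * P.π a * P.V = (b : C) * P.π (E.L a)
      rw [star_mul, star_star, ← P.star_V_mul]
      simp only [mul_assoc]

/-- The homomorphism of `𝒯(A, α, L)` determined by a covariant pair. -/
theorem exists_lift {C : Type u} [CStarAlgebra C] (P : E.CovariantPair C) :
    ∃ ρ : E.Toeplitz →⋆ₙₐ[ℂ] C, (∀ a, ρ (E.i a) = P.π a) ∧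
      (∀ t, ρ (E.S.fst t) = P.V * ρ t) ∧ ∀ t, ρ (E.S.snd t) = ρ t * P.V := by
  obtain ⟨R, ι, h1, h2, h3⟩ := P.exists_rep
  obtain ⟨ρ, ⟨r1, r2, r3⟩, -⟩ := E.existsUnique_lift R.rep
  exact ⟨ι.comp ρ, fun a => (congrArg ι (r1 a)).trans (h1 a),
    fun t => (congrArg ι (r2 t)).trans (h2 _), fun t => (congrArg ι (r3 t)).trans (h3 _)⟩

end CovariantPair

end ExelSystem

/-! ### Block diagonal operators and weighted shifts on Hilbert sums. -/

section HilbertSum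

variable {G : ℕ → Type u} [∀ n, NormedAddCommGroup (G n)]

theorem lp_two_hasSum_norm_sq (x : lp G 2) : HasSum (fun n => ‖x n‖ ^ 2) (‖x‖ ^ 2) := by
  have h := lp.hasSum_norm (p := 2) (by norm_num) x
  simpa using h

theorem lp_two_memℓp {y : ∀ n, G n} (h : Summable fun n => ‖y n‖ ^ 2) : Memℓp y 2 :=
  memℓp_gen (by simpa using h)

variable [∀ n, InnerProductSpace ℂ (G n)]

/-- The block diagonal operator on a Hilbert sum. -/
noncomputable def blockDiagonal (T : ∀ n, G n →L[ℂ] G n) (c : ℝ) (hT : ∀ n, ‖T n‖ ≤ c) :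
    lp G 2 →L[ℂ] lp G 2 :=
  have hc : 0 ≤ c := (norm_nonneg _).trans (hT 0)
  have hb (x : lp G 2) (n : ℕ) : ‖T n (x n)‖ ^ 2 ≤ c ^ 2 * ‖x n‖ ^ 2 := by
    rw [← mul_pow]
    gcongr
    exact (T n).le_of_opNorm_le (hT n) _
  have hs (x : lp G 2) : Summable fun n => ‖T n (x n)‖ ^ 2 :=
    Summable.of_nonneg_of_le (fun _ => sq_nonneg _) (hb x)
      ((lp_two_hasSum_norm_sq x).summable.mul_left _)
  LinearMap.mkContinuous
    { toFun := fun x => ⟨fun n => T n (x n), lp_two_memℓp (hs x)⟩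
      map_add' := fun x y => by ext n; exact map_add (T n) (x n) (y n)
      map_smul' := fun a x => by ext n; exact map_smul (T n) a (x n) }
    c (fun x => by
      refine le_of_sq_le_sq ?_ (by positivity)
      rw [mul_pow]
      have h1 := lp_two_hasSum_norm_sq (⟨fun n => T n (x n), lp_two_memℓp (hs x)⟩ : lp G 2)
      have h2 := hasSum_le (hb x) h1 ((lp_two_hasSum_norm_sq x).mul_left _)
      exact h2)

theorem blockDiagonal_apply (T : ∀ n, G n →L[ℂ] G n) (c : ℝ) (hT : ∀ n, ‖T n‖ ≤ c) (x : lp G 2)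
    (n : ℕ) : blockDiagonal T c hT x n = T n (x n) := rfl

/-- The coordinates of the image of `x` under a weighted shift. -/
def shiftFun (T : ∀ n, G n →L[ℂ] G (n + 1)) (x : ∀ n, G n) : ∀ n, G n
  | 0 => 0
  | n + 1 => T n (x n)

/-- The weighted shift on a Hilbert sum. -/
noncomputable def blockShift (T : ∀ n, G n →L[ℂ] G (n + 1)) (c : ℝ) (hT : ∀ n, ‖T n‖ ≤ c) :
    lp G 2 →L[ℂ] lp G 2 :=
  have hc : 0 ≤ c := (norm_nonneg _).trans (hT 0)
  have hb (x : lp G 2) (n : ℕ) : ‖T n (x n)‖ ^ 2 ≤ c ^ 2 * ‖x n‖ ^ 2 := by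
    rw [← mul_pow]
    gcongr
    exact (T n).le_of_opNorm_le (hT n) _
  have hs (x : lp G 2) : Summable fun n => ‖shiftFun T x n‖ ^ 2 :=
    (summable_nat_add_iff 1).1 (Summable.of_nonneg_of_le (fun _ => sq_nonneg _) (hb x)
      ((lp_two_hasSum_norm_sq x).summable.mul_left _))
  LinearMap.mkContinuous
    { toFun := fun x => ⟨shiftFun T x, lp_two_memℓp (hs x)⟩
      map_add' := fun x y => by
        ext n
        cases n with
        | zero => exact (add_zero (0 : G 0)).symm
        | succ n => exact map_add (T n) (x n) (y n)
      map_smul' := fun a x => by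
        ext n
        cases n with
        | zero => exact (smul_zero (A := G 0) a).symm
        | succ n => exact map_smul (T n) a (x n) }
    c (fun x => by
      refine le_of_sq_le_sq ?_ (by positivity)
      rw [mul_pow]
      have h1 := lp_two_hasSum_norm_sq (⟨shiftFun T x, lp_two_memℓp (hs x)⟩ : lp G 2)
      have h2 := (hasSum_nat_add_iff' 1).2 h1
      have h3 := hasSum_le (hb x) h2 ((lp_two_hasSum_norm_sq x).mul_left _)
      -- The shifted vector has zero entry at index 0, so dropping that term leaves the norm
      -- unchanged.
      have h4 : (0 : ℝ) = ∑ n ∈ Finset.range 1, ‖shiftFun T x n‖ ^ 2 := by simp [shiftFun]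
      refine le_trans (le_of_eq ?_) h3
      exact ((congrArg _ h4.symm).trans (sub_zero _)).symm)

variable (T : ∀ n, G n →L[ℂ] G (n + 1)) (c : ℝ) (hT : ∀ n, ‖T n‖ ≤ c)

theorem blockShift_apply_zero (x : lp G 2) : blockShift T c hT x 0 = 0 := rfl

theorem blockShift_apply_succ (x : lp G 2) (n : ℕ) :
    blockShift T c hT x (n + 1) = T n (x n) := rfl

theorem blockDiagonal_single (T : ∀ n, G n →L[ℂ] G n) (c : ℝ) (hT : ∀ n, ‖T n‖ ≤ c) (n : ℕ)
    (ξ : G n) : blockDiagonal T c hT (lp.single 2 n ξ) = lp.single 2 n (T n ξ) := by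
  ext m
  rw [blockDiagonal_apply]
  rcases eq_or_ne m n with rfl | h
  · rw [lp.single_apply_self, lp.single_apply_self]
  · rw [lp.single_apply_ne _ _ _ h, lp.single_apply_ne _ _ _ h, map_zero]

theorem blockShift_single (n : ℕ) (ξ : G n) :
    blockShift T c hT (lp.single 2 n ξ) = lp.single 2 (n + 1) (T n ξ) := by
  ext m
  cases m with
  | zero => rw [blockShift_apply_zero, lp.single_apply_ne _ _ _ (Nat.succ_ne_zero n).symm]
  | succ m =>
    rw [blockShift_apply_succ]
    rcases eq_or_ne m n with rfl | h
    · rw [lp.single_apply_self, lp.single_apply_self]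
    · rw [lp.single_apply_ne _ _ _ h, lp.single_apply_ne _ _ _ (by simpa using h), map_zero]

variable [∀ n, CompleteSpace (G n)]

theorem adjoint_blockDiagonal (T : ∀ n, G n →L[ℂ] G n) (c : ℝ) (hT : ∀ n, ‖T n‖ ≤ c)
    (hT' : ∀ n, ‖star (T n)‖ ≤ c) :
    star (blockDiagonal T c hT) = blockDiagonal (fun n => star (T n)) c hT' := by
  symm
  rw [ContinuousLinearMap.star_eq_adjoint, ContinuousLinearMap.eq_adjoint_iff]
  intro x y
  rw [lp.inner_eq_tsum, lp.inner_eq_tsum]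
  refine tsum_congr fun n => ?_
  rw [blockDiagonal_apply, blockDiagonal_apply, ContinuousLinearMap.star_eq_adjoint,
    ContinuousLinearMap.adjoint_inner_left]

theorem adjoint_blockShift_apply (x : lp G 2) (n : ℕ) :
    star (blockShift T c hT) x n = ContinuousLinearMap.adjoint (T n) (x (n + 1)) := by
  refine ext_inner_left ℂ fun y => ?_
  rw [← lp.inner_single_left, ContinuousLinearMap.star_eq_adjoint,
    ContinuousLinearMap.adjoint_inner_right, ContinuousLinearMap.adjoint_inner_right,
    lp.inner_eq_tsum, tsum_eq_single (n + 1)]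
  · rw [blockShift_apply_succ, lp.single_apply_self]
  · rintro (_ | m) hm
    · rw [blockShift_apply_zero, inner_zero_left]
    · rw [blockShift_apply_succ, lp.single_apply_ne _ _ _ (by simpa using hm), map_zero,
        inner_zero_left]

theorem adjoint_blockShift_single_zero (ξ : G 0) :
    star (blockShift T c hT) (lp.single 2 0 ξ) = 0 := by
  ext m
  rw [adjoint_blockShift_apply, lp.single_apply_ne _ _ _ (Nat.succ_ne_zero m), map_zero]
  rfl

end HilbertSum

/-! ### Covariant pairs built from blocks. -/

namespace ExelSystem

open scoped InnerProductSpace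

variable {A : Type u} [NonUnitalCStarAlgebra A] {E : ExelSystem A}
variable {G : ℕ → Type u} [∀ n, NormedAddCommGroup (G n)] [∀ n, InnerProductSpace ℂ (G n)]
  [∀ n, CompleteSpace (G n)]

/-- The direct sum of a sequence of representations on Hilbert spaces. -/
noncomputable def diagonalHom (ρ : ∀ n, A →⋆ₙₐ[ℂ] (G n →L[ℂ] G n)) :
    A →⋆ₙₐ[ℂ] (lp G 2 →L[ℂ] lp G 2) where
  toFun a := blockDiagonal (fun n => ρ n a) ‖a‖ fun n => NonUnitalStarAlgHom.norm_apply_le _ _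
  map_smul' c a := by ext x n; simp [blockDiagonal_apply]
  map_zero' := by ext x n; simp [blockDiagonal_apply]
  map_add' a b := by ext x n; simp [blockDiagonal_apply]
  map_mul' a b := by ext x n; simp [blockDiagonal_apply]
  map_star' a := by
    have h : ∀ n, ‖star (ρ n a)‖ ≤ ‖a‖ := fun n => by
      rw [← map_star, ← norm_star a]; exact NonUnitalStarAlgHom.norm_apply_le _ _
    rw [adjoint_blockDiagonal _ _ _ h]
    ext x n
    rw [blockDiagonal_apply, blockDiagonal_apply, map_star]

theorem diagonalHom_apply (ρ : ∀ n, A →⋆ₙₐ[ℂ] (G n →L[ℂ] G n)) (a : A) (x : lp G 2) (n : ℕ) :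
    diagonalHom ρ a x n = ρ n a (x n) := rfl

/-- A covariant pair on a Hilbert sum, given by a sequence of representations and of operators
between consecutive summands. -/
noncomputable def CovariantPair.ofBlocks (ρ : ∀ n, A →⋆ₙₐ[ℂ] (G n →L[ℂ] G n))
    (T : ∀ n, G n →L[ℂ] G (n + 1)) (c : ℝ) (hT : ∀ n, ‖T n‖ ≤ c)
    (h1 : ∀ n a x, T n (ρ n a x) = ρ (n + 1) (E.α a) (T n x))
    (h2 : ∀ n a x y, ⟪T n x, ρ (n + 1) a (T n y)⟫_ℂ = ⟪x, ρ n (E.L a) y⟫_ℂ) :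
    E.CovariantPair (lp G 2 →L[ℂ] lp G 2) where
  π := diagonalHom ρ
  V := blockShift T c hT
  V_mul_π a := by
    ext x n
    cases n with
    | zero => exact (map_zero _).symm
    | succ n => exact h1 n a (x n)
  star_V_mul a := by
    ext x n
    refine ext_inner_left ℂ fun y => ?_
    change ⟪y, star (blockShift T c hT) (diagonalHom ρ a (blockShift T c hT x)) n⟫_ℂ = _
    rw [adjoint_blockShift_apply, ContinuousLinearMap.adjoint_inner_right, diagonalHom_apply,
      blockShift_apply_succ, h2]
    rfl

end ExelSystem

/-! ### The GNS spaces of `f` and `f ∘ L`, and the map between them induced by `α`. -/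

namespace ExelSystem

open Filter Topology UniformSpace Completion
open scoped InnerProductSpace

variable {A : Type u} [NonUnitalCStarAlgebra A] (E : ExelSystem A)
variable [PartialOrder A] [StarOrderedRing A]

theorem L_nonneg {b : A} (hb : 0 ≤ b) : 0 ≤ E.L b := by
  obtain ⟨c, rfl⟩ := CStarAlgebra.nonneg_iff_eq_star_mul_self.1 hb
  obtain ⟨d, hd⟩ := E.positive c
  rw [hd]
  exact star_mul_self_nonneg d

/-- The transfer operator as a positive linear map. -/
noncomputable def positiveL : A →ₚ[ℂ] A :=
  PositiveLinearMap.mk₀ E.L.toLinearMap fun _ => E.L_nonneg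

theorem L_star (a : A) : E.L (star a) = star (E.L a) := map_star E.positiveL a

theorem L_mul_α (a b : A) : E.L (a * E.α b) = E.L a * b := by
  rw [← star_star (a * E.α b), L_star, star_mul, ← map_star E.α, E.L_map_mul, star_mul, L_star,
    star_star, star_star]

/-- With a unit this would be the identity `L(α(a)*α(a)) = a* L(α(1)) a`. An approximate unit `e`
replaces it by `a* L(α(e)*α(e)) a`, and that is at most `‖L‖ a*a`. The inequality is what bounds
`[a] ↦ [α(a)]` on GNS spaces. -/
theorem L_star_map_mul_map_le (a : A) :
    E.L (star (E.α a) * E.α a) ≤ ‖E.L‖ • (star a * a) := by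
  obtain ⟨l, hl, hl1, hs⟩ := exists_approximate_unit A
  have := hl.neBot
  have hc : Continuous E.α := AddMonoidHomClass.continuous_of_bound E.α 1
    (fun a => by simpa using NonUnitalStarAlgHom.norm_apply_le E.α a)
  -- Two factors `e` are inserted so that the middle term is the self-adjoint element
  -- `L(α(e)*α(e))`, to which the conjugation estimate applies.
  have h1 : Tendsto (fun e => e * (e * a)) l (𝓝 a) := by
    have h := hl.tendsto_mul_right a
    rw [tendsto_iff_norm_sub_tendsto_zero] at h ⊢
    have h2 := h.add h
    rw [add_zero] at h2
    refine squeeze_zero' (Eventually.of_forall fun _ => norm_nonneg _) ?_ h2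
    filter_upwards [hl1] with e he
    have h3 : e * (e * a) - a = e * (e * a - a) + (e * a - a) := by rw [mul_sub]; abel
    rw [h3]
    refine (norm_add_le _ _).trans (add_le_add_left ?_ _)
    exact (norm_mul_le _ _).trans (mul_le_of_le_one_left (norm_nonneg _) he)
  have h2 : Tendsto (fun e => E.L (star (E.α a) * E.α (e * (e * a)))) l
      (𝓝 (E.L (star (E.α a) * E.α a))) :=
    (E.L.continuous.tendsto _).comp (((hc.tendsto _).comp h1).const_mul _)
  refine le_of_tendsto h2 ?_
  filter_upwards [hl1, hs] with e he1 he2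
  have h3 : E.L (star (E.α a) * E.α (e * (e * a)))
      = star a * E.L (star (E.α e) * E.α e) * a := by
    rw [map_mul E.α, map_mul E.α, ← map_star, ← map_star, he2, ← mul_assoc (E.α e), ← mul_assoc,
      L_mul_α, E.L_map_mul]
  rw [h3]
  refine (CStarAlgebra.star_left_conjugate_le_norm_smul (E.isSelfAdjoint_L _)).trans ?_
  refine smul_le_smul_of_nonneg_right ?_ (star_mul_self_nonneg a)
  refine (E.L.le_opNorm _).trans (mul_le_of_le_one_right (norm_nonneg _) ?_)
  rw [CStarRing.norm_star_mul_self]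
  have h4 := (NonUnitalStarAlgHom.norm_apply_le E.α e).trans he1
  exact mul_le_one₀ h4 (norm_nonneg _) h4

section GNS

variable (f : A →ₚ[ℂ] ℂ)

theorem comp_positiveL_apply (a : A) : f.comp E.positiveL a = f (E.L a) := rfl

/-- The map `[a] ↦ [α(a)]` from the pre-GNS space of `f` to that of `f ∘ L`. -/
noncomputable def preShift : f.PreGNS →L[ℂ] (f.comp E.positiveL).PreGNS :=
  LinearMap.mkContinuous
    ((f.comp E.positiveL).toPreGNS.toLinearMap ∘ₗ (E.α : A →ₗ[ℂ] A) ∘ₗ f.ofPreGNS.toLinearMap)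
    √‖E.L‖ (fun x => by
      rw [← sq_le_sq₀ (by positivity) (by positivity), mul_pow, Real.sq_sqrt (norm_nonneg _),
        ← Complex.real_le_real, Complex.ofReal_pow, PositiveLinearMap.preGNS_norm_sq]
      refine (OrderHomClass.mono f (E.L_star_map_mul_map_le (f.ofPreGNS x))).trans_eq ?_
      rw [← Complex.coe_smul, map_smul, ← PositiveLinearMap.preGNS_norm_sq]
      simp)

/-- The operator from the GNS space of `f` to that of `f ∘ L` which extends `[a] ↦ [α(a)]`. -/
noncomputable def gnsShift : f.GNS →L[ℂ] (f.comp E.positiveL).GNS :=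
  (E.preShift f).completion

/-- The class of `a` in the GNS space. -/
noncomputable def gnsMk (a : A) : f.GNS := (f.toPreGNS a : f.GNS)

variable {f}

theorem gns_induction {p : f.GNS → Prop} (hp : IsClosed {x | p x}) (h : ∀ a, p (gnsMk f a))
    (x : f.GNS) : p x :=
  UniformSpace.Completion.induction_on x hp fun a => h (f.ofPreGNS a)

theorem inner_gnsMk (a b : A) : ⟪gnsMk f a, gnsMk f b⟫_ℂ = f (star a * b) := by
  rw [gnsMk, gnsMk, UniformSpace.Completion.inner_coe]
  rfl

theorem gnsMk_sub (a b : A) : gnsMk f (a - b) = gnsMk f a - gnsMk f b := by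
  rw [gnsMk, map_sub, UniformSpace.Completion.coe_sub]
  rfl

theorem gns_apply_gnsMk (a b : A) : f.gnsNonUnitalStarAlgHom a (gnsMk f b) = gnsMk f (a * b) := by
  rw [gnsMk, PositiveLinearMap.gnsNonUnitalStarAlgHom_apply_coe]
  rfl

theorem norm_gnsMk_sq (a : A) : ((‖gnsMk f a‖ ^ 2 : ℝ) : ℂ) = f (star a * a) := by
  rw [← inner_gnsMk, inner_self_eq_norm_sq_to_K]
  simp

theorem gns_apply_eq_zero_iff (a : A) :
    f.gnsNonUnitalStarAlgHom a = 0 ↔ ∀ b, f (star (a * b) * (a * b)) = 0 := by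
  have key : ∀ b, f (star (a * b) * (a * b)) = 0 ↔ gnsMk f (a * b) = 0 := by
    intro b
    rw [← norm_gnsMk_sq]
    simp
  simp only [key, ← gns_apply_gnsMk]
  refine ⟨fun h b => by rw [h]; rfl, fun h => ?_⟩
  ext x
  exact gns_induction (p := fun x => f.gnsNonUnitalStarAlgHom a x = (0 : f.GNS →L[ℂ] f.GNS) x)
    (isClosed_eq (by fun_prop) (by fun_prop)) h x

theorem gnsShift_gnsMk (a : A) :
    E.gnsShift f (gnsMk f a) = gnsMk (f.comp E.positiveL) (E.α a) := by
  rw [gnsShift, gnsMk, ContinuousLinearMap.completion_apply_coe]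
  rfl

theorem norm_gnsShift_le : ‖E.gnsShift f‖ ≤ √‖E.L‖ := by
  refine ContinuousLinearMap.opNorm_le_bound _ (Real.sqrt_nonneg _) fun x => ?_
  refine gns_induction (p := fun x => ‖E.gnsShift f x‖ ≤ √‖E.L‖ * ‖x‖)
    (isClosed_le (by fun_prop) (by fun_prop)) (fun a => ?_) x
  rw [gnsMk, gnsShift, ContinuousLinearMap.completion_apply_coe, UniformSpace.Completion.norm_coe,
    UniformSpace.Completion.norm_coe]
  exact (E.preShift f).le_of_opNorm_le
    (LinearMap.mkContinuous_norm_le _ (Real.sqrt_nonneg _) _) _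

theorem gnsShift_gns_apply (a : A) (x : f.GNS) :
    E.gnsShift f (f.gnsNonUnitalStarAlgHom a x) =
      (f.comp E.positiveL).gnsNonUnitalStarAlgHom (E.α a) (E.gnsShift f x) := by
  refine gns_induction (p := fun x => E.gnsShift f (f.gnsNonUnitalStarAlgHom a x) =
      (f.comp E.positiveL).gnsNonUnitalStarAlgHom (E.α a) (E.gnsShift f x))
    (isClosed_eq (by fun_prop) (by fun_prop)) (fun b => ?_) x
  rw [gns_apply_gnsMk, gnsShift_gnsMk, gnsShift_gnsMk, gns_apply_gnsMk, map_mul]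

/-- On classes of elements of `A` this is `f(L(α(b)* a α(c))) = f(b* L(a) c)`, the transfer identity
used on both sides. It yields the relation `V* π(a) V = π(L(a))`. -/
theorem inner_gnsShift_gns_apply (a : A) (x y : f.GNS) :
    ⟪E.gnsShift f x, (f.comp E.positiveL).gnsNonUnitalStarAlgHom a (E.gnsShift f y)⟫_ℂ =
      ⟪x, f.gnsNonUnitalStarAlgHom (E.L a) y⟫_ℂ := by
  refine gns_induction (p := fun x => ⟪E.gnsShift f x,
      (f.comp E.positiveL).gnsNonUnitalStarAlgHom a (E.gnsShift f y)⟫_ℂ =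
        ⟪x, f.gnsNonUnitalStarAlgHom (E.L a) y⟫_ℂ)
    (isClosed_eq (by fun_prop) (by fun_prop)) (fun b => ?_) x
  refine gns_induction (p := fun y => ⟪E.gnsShift f (gnsMk f b),
      (f.comp E.positiveL).gnsNonUnitalStarAlgHom a (E.gnsShift f y)⟫_ℂ =
        ⟪gnsMk f b, f.gnsNonUnitalStarAlgHom (E.L a) y⟫_ℂ)
    (isClosed_eq (by fun_prop) (by fun_prop)) (fun c => ?_) y
  rw [gnsShift_gnsMk, gnsShift_gnsMk, gns_apply_gnsMk, gns_apply_gnsMk, inner_gnsMk, inner_gnsMk,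
    comp_positiveL_apply, ← map_star, E.L_map_mul, E.L_mul_α]

end GNS

end ExelSystem

namespace ExelSystem

open Filter Topology UniformSpace Completion
open scoped InnerProductSpace

variable {A : Type u} [NonUnitalCStarAlgebra A] (E : ExelSystem A)
variable [PartialOrder A] [StarOrderedRing A] (f : A →ₚ[ℂ] ℂ)

/-! ### The Fock representation -/

/-- The positive functionals `f ∘ L ^ n`. -/
noncomputable def iter : ℕ → (A →ₚ[ℂ] ℂ)
  | 0 => f
  | n + 1 => (iter n).comp E.positiveL

/-- The Fock space of `f`: the Hilbert sum of the GNS spaces of the functionals `f ∘ L ^ n`. -/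
abbrev Fock : Type u := lp (fun n => (E.iter f n).GNS) 2

/-- The operators `[a] ↦ [α(a)]` between consecutive summands of the Fock space. -/
noncomputable def fockShift (n : ℕ) : (E.iter f n).GNS →L[ℂ] (E.iter f (n + 1)).GNS :=
  E.gnsShift (E.iter f n)

theorem fockShift_gnsMk (n : ℕ) (a : A) :
    E.fockShift f n (gnsMk (E.iter f n) a) = gnsMk (E.iter f (n + 1)) (E.α a) :=
  E.gnsShift_gnsMk a

theorem norm_fockShift_le (n : ℕ) : ‖E.fockShift f n‖ ≤ √‖E.L‖ := E.norm_gnsShift_le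

theorem fockShift_gns_apply (n : ℕ) (a : A) (x : (E.iter f n).GNS) :
    E.fockShift f n ((E.iter f n).gnsNonUnitalStarAlgHom a x) =
      (E.iter f (n + 1)).gnsNonUnitalStarAlgHom (E.α a) (E.fockShift f n x) :=
  E.gnsShift_gns_apply a x

theorem inner_fockShift_gns_apply (n : ℕ) (a : A) (x y : (E.iter f n).GNS) :
    ⟪E.fockShift f n x, (E.iter f (n + 1)).gnsNonUnitalStarAlgHom a (E.fockShift f n y)⟫_ℂ =
      ⟪x, (E.iter f n).gnsNonUnitalStarAlgHom (E.L a) y⟫_ℂ :=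
  E.inner_gnsShift_gns_apply a x y

/-- The Fock representation of the Exel system on the Fock space of `f`. -/
noncomputable def fock : E.CovariantPair (E.Fock f →L[ℂ] E.Fock f) :=
  CovariantPair.ofBlocks (fun n => (E.iter f n).gnsNonUnitalStarAlgHom) (E.fockShift f) √‖E.L‖
    (E.norm_fockShift_le f) (E.fockShift_gns_apply f) (E.inner_fockShift_gns_apply f)

variable {f}

theorem fock_π_apply (a : A) (x : E.Fock f) (n : ℕ) :
    (E.fock f).π a x n = (E.iter f n).gnsNonUnitalStarAlgHom a (x n) := rfl

theorem fock_V_apply_zero (x : E.Fock f) : (E.fock f).V x 0 = 0 := rfl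

theorem fock_V_apply_succ (x : E.Fock f) (n : ℕ) :
    (E.fock f).V x (n + 1) = E.fockShift f n (x n) := rfl

theorem fock_V :
    (E.fock f).V = blockShift (E.fockShift f) √‖E.L‖ (E.norm_fockShift_le f) := rfl

theorem fock_π (a : A) : (E.fock f).π a = blockDiagonal
    (fun n => (E.iter f n).gnsNonUnitalStarAlgHom a) ‖a‖
      fun _ => NonUnitalStarAlgHom.norm_apply_le _ _ := rfl

theorem fock_star_V_apply (x : E.Fock f) (n : ℕ) :
    (star (E.fock f).V : E.Fock f →L[ℂ] E.Fock f) x n =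
      ContinuousLinearMap.adjoint (E.fockShift f n) (x (n + 1)) :=
  adjoint_blockShift_apply (G := fun n => (E.iter f n).GNS) (E.fockShift f) √‖E.L‖
    (E.norm_fockShift_le f) x n

theorem fock_π_single (a : A) (n : ℕ) (ξ : (E.iter f n).GNS) :
    (E.fock f).π a (lp.single 2 n ξ) =
      lp.single 2 n ((E.iter f n).gnsNonUnitalStarAlgHom a ξ) := by
  rw [fock_π, blockDiagonal_single]

theorem fock_V_single (n : ℕ) (ξ : (E.iter f n).GNS) :
    (E.fock f).V (lp.single 2 n ξ) = lp.single 2 (n + 1) (E.fockShift f n ξ) := by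
  rw [fock_V, blockShift_single]

theorem fock_star_V_single_zero (ξ : (E.iter f 0).GNS) :
    (star (E.fock f).V : E.Fock f →L[ℂ] E.Fock f) (lp.single 2 0 ξ) = 0 := by
  rw [fock_V, adjoint_blockShift_single_zero]

/-- `c α(e)` need not converge to `c` in `A`, but it does in the seminorm of `A_L`. Boundedness of
`g` makes the GNS norm of `g ∘ L` at most a multiple of that seminorm. -/
theorem tendsto_gnsMk_mul_map {l : Filter A} (hl : l.IsApproximateUnit)
    (hl1 : ∀ᶠ e in l, ‖e‖ ≤ 1) (hs : ∀ᶠ e in l, star e = e) (g : A →ₚ[ℂ] ℂ) (c : A) :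
    Tendsto (fun e => gnsMk (g.comp E.positiveL) (c * E.α e)) l
      (𝓝 (gnsMk (g.comp E.positiveL) c)) := by
  obtain ⟨r, hr⟩ := g.exists_norm_apply_le
  rw [tendsto_iff_norm_sub_tendsto_zero]
  have h := (E.tendsto_of_sub_right hl hl1 hs c).const_mul √(r : ℝ)
  rw [mul_zero] at h
  refine squeeze_zero (fun _ => norm_nonneg _) (fun e => ?_) h
  rw [norm_sub_rev, ← gnsMk_sub]
  refine le_of_sq_le_sq ?_ (by positivity)
  rw [mul_pow, Real.sq_sqrt (NNReal.coe_nonneg r), PreModule.norm_of_sq]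
  refine le_trans (le_of_eq ?_) (hr _)
  rw [← comp_positiveL_apply, ← norm_gnsMk_sq, Complex.norm_real, Real.norm_of_nonneg]
  positivity

/-- Operators on the Fock space which agree on the image of `π(A)V` agree on the summands of
positive index. -/
theorem fock_eq_of_mul_V_eq {S T : E.Fock f →L[ℂ] E.Fock f}
    (h : ∀ b, S * ((E.fock f).π b * (E.fock f).V) = T * ((E.fock f).π b * (E.fock f).V))
    (n : ℕ) (ξ : (E.iter f (n + 1)).GNS) :
    S (lp.single 2 (n + 1) ξ) = T (lp.single 2 (n + 1) ξ) := by
  obtain ⟨l, hl, hl1, hs⟩ := exists_approximate_unit A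
  have := hl.neBot
  let J := lp.singleContinuousLinearMap ℂ (fun n => (E.iter f n).GNS) 2 (n + 1)
  refine gns_induction (p := fun ξ => S (J ξ) = T (J ξ))
    (isClosed_eq (by fun_prop) (by fun_prop)) (fun c => ?_) ξ
  have ht := (J.continuous.tendsto _).comp
    (show Tendsto (fun e => gnsMk (E.iter f (n + 1)) (c * E.α e)) l
      (𝓝 (gnsMk (E.iter f (n + 1)) c)) from E.tendsto_gnsMk_mul_map hl hl1 hs (E.iter f n) c)
  refine tendsto_nhds_unique ((S.continuous.tendsto _).comp ht)
    (((T.continuous.tendsto _).comp ht).congr fun e => ?_)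
  -- Testing on the class of `e` in summand `n` produces the class of `c α(e)` in summand `n + 1`.
  -- These converge to the class of `c`, which is why `π(A)V` has dense range in each summand of
  -- positive index.
  have h1 := DFunLike.congr_fun (h c) (lp.single 2 n (gnsMk (E.iter f n) e))
  have h2 : (E.fock f).π c ((E.fock f).V (lp.single 2 n (gnsMk (E.iter f n) e))) =
      J (gnsMk (E.iter f (n + 1)) (c * E.α e)) := by
    rw [fock_V_single, fock_π_single, fockShift_gnsMk, gns_apply_gnsMk]
    rfl
  simp only [mul_apply_eq_comp] at h1
  rw [h2] at h1
  exact h1.symm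

end ExelSystem

/-! ### Faithfulness of `i`, the copy of `M_L` in the Toeplitz algebra, and redundancies as compact
operators. -/

namespace ExelSystem

open Filter Topology

variable {A : Type u} [NonUnitalCStarAlgebra A] (E : ExelSystem A)

section Fock

variable [PartialOrder A] [StarOrderedRing A] (f : A →ₚ[ℂ] ℂ)

/-- The Fock representation as a representation of `𝒯(A, α, L)`. -/
noncomputable def fockHom : E.Toeplitz →⋆ₙₐ[ℂ] (E.Fock f →L[ℂ] E.Fock f) :=
  (E.fock f).exists_lift.choose

theorem fockHom_i (a : A) : E.fockHom f (E.i a) = (E.fock f).π a :=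
  (E.fock f).exists_lift.choose_spec.1 a

theorem fockHom_S_snd (t : E.Toeplitz) :
    E.fockHom f (E.S.snd t) = E.fockHom f t * (E.fock f).V :=
  (E.fock f).exists_lift.choose_spec.2.2 t

theorem fockHom_πV (a : A) :
    E.fockHom f (E.universalRep.πV a) = (E.fock f).π a * (E.fock f).V :=
  (E.fockHom_S_snd f _).trans (congrArg (· * _) (E.fockHom_i f a))

theorem gns_eq_zero_of_fock_π_eq_zero {f : A →ₚ[ℂ] ℂ} {a : A} (h : (E.fock f).π a = 0) :
    f.gnsNonUnitalStarAlgHom a = 0 := by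
  ext ξ
  have h1 := E.fock_π_single (f := f) a 0 ξ
  rw [h] at h1
  have h2 := congrArg (fun x : E.Fock f => x 0) h1
  simp only [lp.single_apply_self] at h2
  exact h2.symm

end Fock

theorem eq_zero_of_forall_functional_mul [PartialOrder A] [StarOrderedRing A] {a : A}
    (h : ∀ (f : A →ₚ[ℂ] ℂ) (b : A), f (star (a * b) * (a * b)) = 0) : a = 0 :=
  eq_of_forall_mul_right fun b => by
    rw [zero_mul]
    exact eq_zero_of_forall_positive_functional fun f => h f b

/-- Summand zero of the Fock representation of `f` is the GNS representation of `f`, and positive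
functionals separate the elements of `A`. -/
theorem injective_i : Function.Injective E.i := by
  let _ := CStarAlgebra.spectralOrder A
  let _ := CStarAlgebra.spectralOrderedRing A
  refine (injective_iff_map_eq_zero E.i).2 fun a ha => ?_
  refine eq_zero_of_forall_functional_mul fun f => (gns_apply_eq_zero_iff (f := f) a).1 ?_
  refine E.gns_eq_zero_of_fock_π_eq_zero ?_
  rw [← fockHom_i, ha, map_zero]

theorem norm_i (a : A) : ‖E.i a‖ = ‖a‖ :=
  NonUnitalStarAlgHom.norm_map E.i E.injective_i a

/-- Since `(i(a)S)* i(a)S = i(L(a*a))`, this rests on `i` being isometric. It is what allows norms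
in `M_L` to be computed in the Toeplitz algebra. -/
theorem norm_πV (a : A) : ‖E.universalRep.πV a‖ = ‖E.q a‖ := by
  refine (sq_eq_sq₀ (norm_nonneg _) (norm_nonneg _)).1 ?_
  rw [norm_q_sq, sq, ← CStarRing.norm_star_mul_self, ToeplitzRep.star_πV_mul_πV]
  exact E.norm_i _

/-- The isometry `q(a) ↦ i(a) S` of `M_L` into `𝒯(A, α, L)`. -/
noncomputable def ψ : E.M →L[ℂ] E.Toeplitz :=
  ContinuousLinearMap.extend
    (LinearMap.mkContinuous
      ((E.S.snd : E.Toeplitz →ₗ[ℂ] E.Toeplitz) ∘ₗ (E.i : A →ₗ[ℂ] E.Toeplitz) ∘ₗ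
        (PreModule.of E).symm.toLinearMap) 1
      (fun x => by
        rw [one_mul]
        exact E.universalRep.norm_πV_le _)) E.qL

theorem ψ_q (a : A) : E.ψ (E.q a) = E.universalRep.πV a := by
  rw [ψ, q, ContinuousLinearMap.extend_eq _ E.denseRange_qL E.isUniformInducing_qL]
  rfl

theorem norm_ψ (x : E.M) : ‖E.ψ x‖ = ‖x‖ := by
  refine M_induction (p := fun x => ‖E.ψ x‖ = ‖x‖) (isClosed_eq (by fun_prop) (by fun_prop))
    (fun a => ?_) x
  rw [ψ_q, norm_πV]

theorem coe_eq_i_mul_S_mul_star_S_mul_i_iff {k : E.Toeplitz} {a b : A} :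
    (k : 𝓜(ℂ, E.Toeplitz)) = E.i a * E.S * star E.S * E.i b ↔
      k = E.universalRep.πV a * star (E.universalRep.πV (star b)) := by
  have h : ((E.universalRep.πV a * star (E.universalRep.πV (star b)) : E.Toeplitz) :
      𝓜(ℂ, E.Toeplitz)) = E.i a * E.S * star E.S * E.i b := by
    rw [multiplier_coe_mul_coe, multiplier_coe_star, ToeplitzRep.coe_πV, ToeplitzRep.coe_πV,
      star_mul, ← multiplier_coe_star]
    change (E.i a : 𝓜(ℂ, E.Toeplitz)) * E.S * (star E.S * (star (E.i (star b)) : E.Toeplitz)) = _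
    rw [← map_star, star_star]
    simp only [mul_assoc]
  rw [← h]
  exact ⟨multiplier_coe_injective, fun h => by rw [h]⟩

variable {E}

theorem IsRedundancy.mul_πV {a : A} {k : E.Toeplitz} (h : E.IsRedundancy a k) (b : A) :
    E.i a * E.universalRep.πV b = k * E.universalRep.πV b := by
  apply multiplier_coe_injective
  rw [multiplier_coe_mul_coe, multiplier_coe_mul_coe, ToeplitzRep.coe_πV]
  have := h.2 b
  simp only [mul_assoc] at this
  exact this

variable (E)

/-- Each `i(ab)S` has the norm of `q(ab)`, which the hypothesis makes zero. This is the source of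
the necessity of almost faithfulness. -/
theorem isRedundancy_zero {a : A} (h : ∀ b, E.L (star (a * b) * (a * b)) = 0) :
    E.IsRedundancy a 0 := by
  refine ⟨zero_mem _, fun b => ?_⟩
  have h1 : E.universalRep.πV (a * b) = 0 := by
    rw [← norm_eq_zero, norm_πV, ← sq_eq_zero_iff, norm_q_sq, h b, norm_zero]
  have h2 : ((0 : E.Toeplitz) : 𝓜(ℂ, E.Toeplitz)) = 0 :=
    map_zero (DoubleCentralizer.coeHom (𝕜 := ℂ))
  rw [← multiplier_coe_mul_coe, ← map_mul]
  refine (E.universalRep.coe_πV (a * b)).symm.trans ?_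
  rw [h1, h2, zero_mul, zero_mul]

/-- Elements of the span of `i(A) S S* i(A)` act on `i(A) S` as finite rank operators on `M_L`. -/
theorem exists_finiteRank {k : E.Toeplitz} (hk : k ∈ Submodule.span ℂ {k : E.Toeplitz |
    ∃ a b : A, (k : 𝓜(ℂ, E.Toeplitz)) = E.i a * E.S * star E.S * E.i b}) :
    ∃ T ∈ Submodule.span ℂ {T | ∃ x y : E.M, T = E.Θ x y},
      ∀ c, k * E.universalRep.πV c = E.ψ (T (E.q c)) := by
  induction hk using Submodule.span_induction with
  | mem k hk =>
    obtain ⟨a, b, h⟩ := hk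
    refine ⟨E.Θ (E.q a) (E.q (star b)), Submodule.subset_span ⟨_, _, rfl⟩, fun c => ?_⟩
    rw [(E.coe_eq_i_mul_S_mul_star_S_mul_i_iff).1 h, mul_assoc, ToeplitzRep.star_πV_mul_πV, Θ,
      ContinuousLinearMap.comp_apply, inner_q_q, right_q, ψ_q, ToeplitzRep.πV_mul_π]
  | zero => exact ⟨0, zero_mem _, fun c => by simp⟩
  | add k k' _ _ hk hk' =>
    obtain ⟨T, hT, h⟩ := hk
    obtain ⟨T', hT', h'⟩ := hk'
    exact ⟨T + T', add_mem hT hT', fun c => by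
      rw [add_mul, h, h', add_apply, map_add]⟩
  | smul r k _ hk =>
    obtain ⟨T, hT, h⟩ := hk
    exact ⟨r • T, Submodule.smul_mem _ _ hT, fun c => by
      rw [smul_mul_assoc, h, smul_apply, map_smul]⟩

variable {E}

/-- Under the isometry `ψ`, left multiplication by `k` corresponds to `φ(a)`, and approximants of
`k` in the span correspond to finite rank operators. Hence `φ(a)` is a norm limit of finite rank
operators. -/
theorem IsRedundancy.mem_J {a : A} {k : E.Toeplitz} (h : E.IsRedundancy a k) : a ∈ E.J := by
  change E.φ a ∈ closure _
  rw [Metric.mem_closure_iff]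
  intro ε hε
  obtain ⟨k', hk', hd⟩ := Metric.mem_closure_iff.1 (show k ∈ closure _ from h.1) (ε / 2)
    (by positivity)
  obtain ⟨T, hT, hTk⟩ := E.exists_finiteRank hk'
  refine ⟨T, hT, ?_⟩
  rw [dist_eq_norm] at hd ⊢
  refine lt_of_le_of_lt ?_ (half_lt_self hε)
  refine ContinuousLinearMap.opNorm_le_bound _ (by positivity) fun x => ?_
  refine M_induction (p := fun x => ‖(E.φ a - T) x‖ ≤ ε / 2 * ‖x‖)
    (isClosed_le (by fun_prop) (by fun_prop)) (fun b => ?_) x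
  rw [← norm_ψ, ← norm_πV, sub_apply, map_sub, ← hTk, φ_q, ψ_q]
  have h1 : E.universalRep.πV (a * b) = k * E.universalRep.πV b := by
    rw [← h.mul_πV, ← ToeplitzRep.π_mul_πV]
    rfl
  rw [h1, ← sub_mul]
  exact (norm_mul_le _ _).trans (by gcongr)

theorem IsRedundancy.mem_Kα {a : A} {k : E.Toeplitz} (ha : a ∈ E.closureAαA)
    (h : E.IsRedundancy a k) : a ∈ E.Kα := ⟨ha, h.mem_J⟩

end ExelSystem

/-! ### The redundancy ideal, and the action of redundancies in the Fock representations. -/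

namespace ExelSystem

open Filter Topology

variable {A : Type u} [NonUnitalCStarAlgebra A] (E : ExelSystem A)

section Ideal

variable {E}

theorem mem_of_mem_redundancyIdeal {I : TwoSidedIdeal E.Toeplitz}
    (hI : IsClosed (I : Set E.Toeplitz))
    (h : ∀ a k, a ∈ E.closureAαA → E.IsRedundancy a k → E.i a - k ∈ I) {t : E.Toeplitz}
    (ht : t ∈ E.redundancyIdeal) : t ∈ I :=
  (TwoSidedIdeal.mem_sInf _).1 ht I ⟨hI, h⟩

theorem sub_mem_redundancyIdeal {a : A} {k : E.Toeplitz} (ha : a ∈ E.closureAαA)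
    (h : E.IsRedundancy a k) : E.i a - k ∈ E.redundancyIdeal :=
  (TwoSidedIdeal.mem_sInf _).2 fun _ hI => hI.2 a k ha h

variable (E)

theorem isClosed_redundancyIdeal : IsClosed (E.redundancyIdeal : Set E.Toeplitz) := by
  have h : (E.redundancyIdeal : Set E.Toeplitz) =
      ⋂ I ∈ {I : TwoSidedIdeal E.Toeplitz | IsClosed (I : Set E.Toeplitz) ∧
        ∀ (a : A) (k : E.Toeplitz), a ∈ E.closureAαA → E.IsRedundancy a k → E.i a - k ∈ I},
        (I : Set E.Toeplitz) := by
    ext t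
    simp only [Set.mem_iInter, SetLike.mem_coe]
    exact TwoSidedIdeal.mem_sInf _
  rw [h]
  exact isClosed_biInter fun I hI => hI.1

theorem Q_eq_iff (s t : E.Toeplitz) : E.Q s = E.Q t ↔ s - t ∈ E.redundancyIdeal :=
  (RingCon.eq _).trans (TwoSidedIdeal.rel_iff _ _ _)

theorem injective_Q_comp_i_iff :
    Function.Injective (E.Q ∘ E.i) ↔ ∀ a, E.i a ∈ E.redundancyIdeal → a = 0 := by
  constructor
  · intro h a ha
    refine h ((E.Q_eq_iff _ _).2 ?_)
    rwa [map_zero, sub_zero]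
  · intro h a b hab
    have := (E.Q_eq_iff _ _).1 hab
    rw [← map_sub] at this
    exact sub_eq_zero.1 (h _ this)

/-- Elements of a set which is closed under the algebraic operations and contains the generators
of `𝒯(A, α, L)` are dense. -/
theorem dense_toeplitz {p : E.Toeplitz → Prop} (h0 : p 0) (hadd : ∀ s t, p s → p t → p (s + t))
    (hmul : ∀ s t, p s → p t → p (s * t)) (hsmul : ∀ (c : ℂ) t, p t → p (c • t))
    (hi : ∀ a, p (E.i a)) (hV : ∀ a, p (E.universalRep.πV a))
    (hV' : ∀ a, p (star (E.universalRep.πV a))) : Dense {t | p t} := by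
  have key : ∀ x (_ : x ∈ NonUnitalAlgebra.adjoin ℂ
      ((Set.range E.prodπ ∪ Set.range E.prodπV) ∪ star (Set.range E.prodπ ∪ Set.range E.prodπV))),
      ∃ hx' : x ∈ E.toeplitzSubalgebra, p ⟨x, hx'⟩ := by
    intro x hx
    induction hx using NonUnitalAlgebra.adjoin_induction with
    | mem x hx =>
      rcases hx with (⟨a, rfl⟩ | ⟨a, rfl⟩) | ⟨a, ha⟩ | ⟨a, ha⟩
      · exact ⟨E.prodπ_mem a, hi a⟩
      · exact ⟨E.prodπV_mem a, hV a⟩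
      · rw [← star_star x, ← ha, ← map_star]
        exact ⟨E.prodπ_mem _, hi _⟩
      · rw [← star_star x, ← ha]
        exact ⟨star_mem (E.prodπV_mem a), hV' a⟩
    | add x y _ _ hx hy =>
      exact ⟨add_mem hx.1 hy.1, hadd _ _ hx.2 hy.2⟩
    | zero => exact ⟨zero_mem _, h0⟩
    | mul x y _ _ hx hy => exact ⟨mul_mem hx.1 hy.1, hmul _ _ hx.2 hy.2⟩
    | smul c x _ hx => exact ⟨SMulMemClass.smul_mem c hx.1, hsmul c _ hx.2⟩
  intro t
  rw [closure_subtype]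
  refine closure_mono (fun x hx => ?_) t.2
  obtain ⟨h1, h2⟩ := key x hx
  exact ⟨⟨x, h1⟩, h2, rfl⟩

end Ideal

section Fock

variable [PartialOrder A] [StarOrderedRing A] {f : A →ₚ[ℂ] ℂ}

variable (f) in
theorem continuous_fockHom : Continuous (E.fockHom f) :=
  AddMonoidHomClass.continuous_of_bound (E.fockHom f) 1
    (fun a => by simpa using NonUnitalStarAlgHom.norm_apply_le (E.fockHom f) a)

theorem norm_fockHom_apply_le (t : E.Toeplitz) (x : E.Fock f) :
    ‖E.fockHom f t x‖ ≤ ‖t‖ * ‖x‖ :=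
  ContinuousLinearMap.le_of_opNorm_le _ (NonUnitalStarAlgHom.norm_apply_le _ _) x

theorem norm_fock_apply_le (x : E.Fock f) (n : ℕ) : ‖x n‖ ≤ ‖x‖ :=
  lp.norm_apply_le_norm (E := fun n => (E.iter f n).GNS) two_ne_zero x n

theorem norm_fock_single (n : ℕ) (ξ : (E.iter f n).GNS) :
    ‖(lp.single 2 n ξ : E.Fock f)‖ = ‖ξ‖ :=
  lp.norm_single (E := fun n => (E.iter f n).GNS) two_pos n ξ

/-- Evaluation of the Fock representation at a vector. -/
noncomputable def fockEval (x : E.Fock f) : E.Toeplitz →L[ℂ] E.Fock f :=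
  (ContinuousLinearMap.apply ℂ (E.Fock f) x).comp
    { toLinearMap := (E.fockHom f : E.Toeplitz →ₗ[ℂ] (E.Fock f →L[ℂ] E.Fock f))
      cont := E.continuous_fockHom f }

theorem fockEval_apply (x : E.Fock f) (t : E.Toeplitz) : E.fockEval x t = E.fockHom f t x := rfl

theorem fockHom_πV_mul_star_πV_single_zero (a b : A) (ξ : (E.iter f 0).GNS) :
    E.fockHom f (E.universalRep.πV a * star (E.universalRep.πV b)) (lp.single 2 0 ξ) = 0 := by
  have h : E.fockHom f (E.universalRep.πV a * star (E.universalRep.πV b)) =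
      ((E.fock f).π a * (E.fock f).V) * (star (E.fock f).V * (E.fock f).π (star b)) := by
    rw [map_mul, map_star, fockHom_πV, fockHom_πV, star_mul, ← map_star]
  rw [h]
  change (E.fock f).π a ((E.fock f).V ((star (E.fock f).V : E.Fock f →L[ℂ] E.Fock f)
    ((E.fock f).π (star b) (lp.single 2 0 ξ)))) = 0
  rw [fock_π_single, fock_star_V_single_zero, map_zero, map_zero]

/-- Every generator of the span has the form `i(a)S S*i(b)`. The diagonal `i(b)` preserves summand
zero, and `S*` annihilates it. -/
theorem fockHom_apply_single_zero {k : E.Toeplitz} (hk : k ∈ E.spanSS) (ξ : (E.iter f 0).GNS) :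
    E.fockHom f k (lp.single 2 0 ξ) = 0 := by
  rw [← fockEval_apply]
  change k ∈ (E.fockEval (lp.single 2 0 ξ : E.Fock f)).ker
  refine Submodule.topologicalClosure_minimal _ (Submodule.span_le.2 ?_)
    (ContinuousLinearMap.isClosed_ker _) hk
  rintro k ⟨a, b, h⟩
  rw [E.coe_eq_i_mul_S_mul_star_S_mul_i_iff.1 h]
  exact E.fockHom_πV_mul_star_πV_single_zero a (star b) ξ

/-- The image of `i(a) - k` under the Fock representation, for a redundancy `(i(a), k)`. -/
theorem fockHom_redundancy {a : A} {k : E.Toeplitz} (h : E.IsRedundancy a k) (x : E.Fock f) :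
    E.fockHom f (E.i a - k) x =
      lp.single 2 0 ((E.iter f 0).gnsNonUnitalStarAlgHom a (x 0)) := by
  -- The comparison is made on each summand: on summand zero `k` acts as zero, and on the others
  -- `i(a)` and `k` agree because they agree on `i(A)S`.
  let T : E.Fock f →L[ℂ] E.Fock f :=
    (lp.singleContinuousLinearMap ℂ (fun n => (E.iter f n).GNS) 2 0).comp
      (((E.iter f 0).gnsNonUnitalStarAlgHom a).comp
        (lp.evalCLM ℂ (fun n => (E.iter f n).GNS) 2 0))
  suffices hT : E.fockHom f (E.i a - k) = T from DFunLike.congr_fun hT x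
  refine lp.ext_continuousLinearMap (by norm_num) fun n => ?_
  ext1 ξ
  change E.fockHom f (E.i a - k) (lp.single 2 n ξ) =
    lp.single 2 0 ((E.iter f 0).gnsNonUnitalStarAlgHom a ((lp.single 2 n ξ : E.Fock f) 0))
  rw [map_sub, sub_apply]
  cases n with
  | zero =>
    rw [E.fockHom_apply_single_zero h.1, sub_zero, fockHom_i, fock_π_single, lp.single_apply_self]
  | succ n =>
    rw [lp.single_apply_ne _ _ _ (Nat.succ_ne_zero n).symm, map_zero, lp.single_zero, sub_eq_zero]
    refine E.fock_eq_of_mul_V_eq (fun b => ?_) n ξ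
    rw [← fockHom_πV, ← map_mul, ← map_mul, h.mul_πV]

end Fock

end ExelSystem

/-! ### Two constraints on the redundancy ideal: its preimage lies in `K_α`, and its elements vanish
at infinity. -/

namespace ExelSystem

open Filter Topology

variable {A : Type u} [NonUnitalCStarAlgebra A] (E : ExelSystem A)

section Kernel

variable [PartialOrder A] [StarOrderedRing A]

/-- The Fock representation of a functional which vanishes on `K_α` kills the redundancies. -/
theorem fockHom_eq_zero_of_mem_redundancyIdeal {f : A →ₚ[ℂ] ℂ} (hf : ∀ a ∈ E.Kα, f a = 0)
    {t : E.Toeplitz} (ht : t ∈ E.redundancyIdeal) : E.fockHom f t = 0 := by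
  let I : TwoSidedIdeal E.Toeplitz := TwoSidedIdeal.mk' {t | E.fockHom f t = 0}
    (map_zero _)
    (fun {x y} (hx : E.fockHom f x = 0) (hy : E.fockHom f y = 0) =>
      show E.fockHom f (x + y) = 0 by rw [map_add, hx, hy, add_zero])
    (fun {x} (hx : E.fockHom f x = 0) => show E.fockHom f (-x) = 0 by rw [map_neg, hx, neg_zero])
    (fun {x y} (hy : E.fockHom f y = 0) =>
      show E.fockHom f (x * y) = 0 by rw [map_mul, hy, mul_zero])
    (fun {x y} (hx : E.fockHom f x = 0) =>
      show E.fockHom f (x * y) = 0 by rw [map_mul, hx, zero_mul])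
  have hI : (I : Set E.Toeplitz) = {t | E.fockHom f t = 0} := TwoSidedIdeal.coe_mk' _ _ _ _ _ _
  have h : t ∈ (I : Set E.Toeplitz) := by
    refine mem_of_mem_redundancyIdeal ?_ (fun a k ha hk => ?_) ht
    · rw [hI]
      exact isClosed_eq (E.continuous_fockHom f) continuous_const
    · rw [← SetLike.mem_coe, hI]
      -- The first component `a` of an admissible redundancy lies in `K_α`, which is an ideal, so
      -- `f` vanishes at every `(ab)*ab`.
      have h0 : (E.iter f 0).gnsNonUnitalStarAlgHom a = 0 :=
        (gns_apply_eq_zero_iff (f := f) a).2 fun b =>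
          hf _ (mul_mem_Kα _ (mul_mem_Kα_right E (hk.mem_Kα ha) b))
      refine ContinuousLinearMap.ext fun x => ?_
      rw [E.fockHom_redundancy hk, h0]
      exact lp.single_zero _ _
  rw [hI] at h
  exact h

end Kernel

/-- A functional that vanishes on `K_α` has a Fock representation killing `i(c)`, so its GNS
representation kills `c`. If some `cb` were outside `K_α`, a separating functional would contradict
this. -/
theorem mem_Kα_of_i_mem {c : A} (hc : E.i c ∈ E.redundancyIdeal) : c ∈ E.Kα := by
  let _ := CStarAlgebra.spectralOrder A
  let _ := CStarAlgebra.spectralOrderedRing A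
  have h : ∀ b, c * b ∈ E.Kα := by
    intro b
    by_contra hb
    obtain ⟨f, hf, hfb⟩ := exists_positive_functional (K := E.KαSubalgebra) E.isClosed_Kα
      (fun a x hx => mul_mem_Kα a hx) hb
    refine hfb ((gns_apply_eq_zero_iff (f := f) c).1 (E.gns_eq_zero_of_fock_π_eq_zero ?_) b)
    rw [← fockHom_i]
    exact E.fockHom_eq_zero_of_mem_redundancyIdeal hf hc
  -- The separation argument only reaches the products `cb`. An approximate unit and closedness of
  -- `K_α` recover `c`.
  obtain ⟨l, hl, -, -⟩ := exists_approximate_unit A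
  have := hl.neBot
  exact E.isClosed_Kα.mem_of_tendsto (hl.tendsto_mul_left c) (Eventually.of_forall h)

section Vanishing

variable [PartialOrder A] [StarOrderedRing A]

/-- The image of `t` under the Fock representations is small, uniformly in the functional, on the
summands of large index. -/
def VanishesAtInfinity (t : E.Toeplitz) : Prop :=
  ∀ ε > 0, ∃ n₀, ∀ n ≥ n₀, ∀ (f : A →ₚ[ℂ] ℂ) (ξ : (E.iter f n).GNS),
    ‖E.fockHom f t (lp.single 2 n ξ)‖ ≤ ε * ‖ξ‖

/-- The images of `t` under the Fock representations lower degrees by a bounded amount. -/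
def IsBanded (t : E.Toeplitz) : Prop :=
  ∃ N, ∀ (f : A →ₚ[ℂ] ℂ) (x : E.Fock f) (n : ℕ), (∀ m < n + N, x m = 0) →
    ∀ m < n, E.fockHom f t x m = 0

theorem dense_isBanded : Dense {t : E.Toeplitz | E.IsBanded t} := by
  refine E.dense_toeplitz ?_ ?_ ?_ ?_ ?_ ?_ ?_
  · refine ⟨0, fun f x n _ m _ => ?_⟩
    rw [map_zero]
    rfl
  · rintro s t ⟨N, hs⟩ ⟨N', ht⟩
    refine ⟨max N N', fun f x n hx m hm => ?_⟩
    rw [map_add]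
    change E.fockHom f s x m + E.fockHom f t x m = 0
    rw [hs f x n (fun m hm => hx m (hm.trans_le (by gcongr; exact le_max_left _ _))) m hm,
      ht f x n (fun m hm => hx m (hm.trans_le (by gcongr; exact le_max_right _ _))) m hm, add_zero]
  · rintro s t ⟨N, hs⟩ ⟨N', ht⟩
    refine ⟨N + N', fun f x n hx m hm => ?_⟩
    rw [map_mul]
    change E.fockHom f s (E.fockHom f t x) m = 0
    exact hs f _ n (ht f x (n + N) (by rwa [add_assoc])) m hm
  · rintro c t ⟨N, ht⟩
    refine ⟨N, fun f x n hx m hm => ?_⟩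
    rw [map_smul]
    change c • E.fockHom f t x m = 0
    rw [ht f x n hx m hm, smul_zero]
  · refine fun a => ⟨0, fun f x n hx m hm => ?_⟩
    rw [fockHom_i, fock_π_apply, hx m hm, map_zero]
  · refine fun a => ⟨0, fun f x n hx m hm => ?_⟩
    rw [fockHom_πV]
    change (E.fock f).π a ((E.fock f).V x) m = 0
    rw [fock_π_apply]
    cases m with
    | zero => rw [fock_V_apply_zero, map_zero]
    | succ m => rw [fock_V_apply_succ, hx m (by omega), map_zero, map_zero]
  · refine fun a => ⟨1, fun f x n hx m hm => ?_⟩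
    have h : E.fockHom f (star (E.universalRep.πV a)) =
        star (E.fock f).V * (E.fock f).π (star a) := by
      rw [map_star, fockHom_πV, star_mul, ← map_star]
    rw [h]
    change (star (E.fock f).V : E.Fock f →L[ℂ] E.Fock f) ((E.fock f).π (star a) x) m = 0
    rw [fock_star_V_apply, fock_π_apply, hx (m + 1) (by omega), map_zero, map_zero]

theorem fockHom_sub_apply {f : A →ₚ[ℂ] ℂ} (s t : E.Toeplitz) (x : E.Fock f) :
    E.fockHom f (s - t) x = E.fockHom f s x - E.fockHom f t x := by
  rw [map_sub]
  rfl

theorem fockHom_add_apply {f : A →ₚ[ℂ] ℂ} (s t : E.Toeplitz) (x : E.Fock f) :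
    E.fockHom f (s + t) x = E.fockHom f s x + E.fockHom f t x := by
  rw [map_add]
  rfl

theorem fockHom_mul_apply {f : A →ₚ[ℂ] ℂ} (s t : E.Toeplitz) (x : E.Fock f) :
    E.fockHom f (s * t) x = E.fockHom f s (E.fockHom f t x) := by
  rw [map_mul]
  rfl

/-- A banded approximant of `t` lowers degrees by at most some `N`, so it cannot carry a vector of
large degree into summand zero. Only the approximation error contributes there. -/
theorem exists_norm_fockHom_single_zero_le (t : E.Toeplitz) {ε : ℝ} (hε : 0 < ε) :
    ∃ n₀, ∀ n ≥ n₀, ∀ (f : A →ₚ[ℂ] ℂ) (ξ : (E.iter f n).GNS),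
      ‖E.fockHom f t (lp.single 2 n ξ) 0‖ ≤ ε * ‖ξ‖ := by
  obtain ⟨s, ⟨N, hs⟩, hd⟩ := Metric.dense_iff.1 E.dense_isBanded t ε hε |>.imp fun _ h => h.symm
  rw [Metric.mem_ball, dist_comm, dist_eq_norm] at hd
  -- Beyond the band width `N`, the extra 1 ensures that component 0 is among those that vanish.
  refine ⟨1 + N, fun n hn f ξ => ?_⟩
  have h0 : E.fockHom f s (lp.single 2 n ξ) 0 = 0 :=
    hs f _ 1 (fun m hm => lp.single_apply_ne _ _ _ (by omega)) 0 one_pos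
  have h1 : E.fockHom f t (lp.single 2 n ξ) 0 = E.fockHom f (t - s) (lp.single 2 n ξ) 0 := by
    rw [fockHom_sub_apply]
    change _ = E.fockHom f t (lp.single 2 n ξ) 0 - E.fockHom f s (lp.single 2 n ξ) 0
    rw [h0, sub_zero]
  rw [h1]
  refine (norm_fock_apply_le E _ 0).trans ((E.norm_fockHom_apply_le _ _).trans ?_)
  rw [norm_fock_single]
  gcongr

variable {E}

theorem VanishesAtInfinity.add {s t : E.Toeplitz} (hs : E.VanishesAtInfinity s)
    (ht : E.VanishesAtInfinity t) : E.VanishesAtInfinity (s + t) := by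
  intro ε hε
  obtain ⟨n, hn⟩ := hs (ε / 2) (by positivity)
  obtain ⟨m, hm⟩ := ht (ε / 2) (by positivity)
  refine ⟨max n m, fun k hk f ξ => ?_⟩
  rw [fockHom_add_apply]
  refine (norm_add_le _ _).trans ((add_le_add (hn k (le_of_max_le_left hk) f ξ)
    (hm k (le_of_max_le_right hk) f ξ)).trans_eq ?_)
  ring

theorem VanishesAtInfinity.mul_left (s : E.Toeplitz) {t : E.Toeplitz}
    (ht : E.VanishesAtInfinity t) : E.VanishesAtInfinity (s * t) := by
  intro ε hε
  obtain ⟨m, hm⟩ := ht (ε / (‖s‖ + 1)) (by positivity)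
  refine ⟨m, fun k hk f ξ => ?_⟩
  rw [fockHom_mul_apply]
  calc ‖E.fockHom f s (E.fockHom f t (lp.single 2 k ξ))‖
      ≤ ‖s‖ * (ε / (‖s‖ + 1) * ‖ξ‖) :=
        (E.norm_fockHom_apply_le _ _).trans (by gcongr; exact hm k hk f ξ)
    _ ≤ (‖s‖ + 1) * (ε / (‖s‖ + 1) * ‖ξ‖) := by gcongr; linarith
    _ = ε * ‖ξ‖ := by field_simp

theorem VanishesAtInfinity.neg {t : E.Toeplitz} (ht : E.VanishesAtInfinity t) :
    E.VanishesAtInfinity (-t) := by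
  intro ε hε
  obtain ⟨m, hm⟩ := ht ε hε
  refine ⟨m, fun k hk f ξ => ?_⟩
  rw [map_neg]
  exact (norm_neg (E.fockHom f t (lp.single 2 k ξ))).trans_le (hm k hk f ξ)

variable (E)

theorem vanishesAtInfinity_zero : E.VanishesAtInfinity 0 := by
  refine fun ε hε => ⟨0, fun k _ f ξ => ?_⟩
  rw [map_zero]
  change ‖(0 : E.Fock f)‖ ≤ _
  rw [norm_zero]
  positivity

theorem isClosed_vanishesAtInfinity : IsClosed {t : E.Toeplitz | E.VanishesAtInfinity t} := by
  refine isClosed_of_closure_subset fun t ht ε hε => ?_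
  obtain ⟨s, hs, hd⟩ := Metric.mem_closure_iff.1 ht (ε / 2) (by positivity)
  obtain ⟨m, hm⟩ := hs (ε / 2) (by positivity)
  refine ⟨m, fun k hk f ξ => ?_⟩
  rw [dist_eq_norm] at hd
  rw [← sub_add_cancel t s, fockHom_add_apply]
  have h1 : ‖E.fockHom f (t - s) (lp.single 2 k ξ)‖ ≤ ε / 2 * ‖ξ‖ := by
    refine (E.norm_fockHom_apply_le _ _).trans ?_
    rw [norm_fock_single]
    gcongr
  refine (norm_add_le _ _).trans ((add_le_add h1 (hm k hk f ξ)).trans_eq ?_)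
  ring

variable {E}

theorem IsRedundancy.vanishesAtInfinity {a : A} {k : E.Toeplitz} (h : E.IsRedundancy a k) :
    E.VanishesAtInfinity (E.i a - k) := by
  refine fun ε hε => ⟨1, fun n hn f ξ => ?_⟩
  rw [E.fockHom_redundancy h, lp.single_apply_ne _ _ _ (by omega), map_zero, lp.single_zero,
    norm_zero]
  positivity

/-- The redundancy `i(a) - k` sees only component zero of `tξ`, and that component is small when `ξ`
has large degree. -/
theorem IsRedundancy.vanishesAtInfinity_mul {a : A} {k : E.Toeplitz} (h : E.IsRedundancy a k)
    (t : E.Toeplitz) : E.VanishesAtInfinity ((E.i a - k) * t) := by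
  intro ε hε
  obtain ⟨m, hm⟩ := E.exists_norm_fockHom_single_zero_le t (ε := ε / (‖a‖ + 1)) (by positivity)
  refine ⟨m, fun n hn f ξ => ?_⟩
  rw [fockHom_mul_apply, E.fockHom_redundancy h, norm_fock_single]
  calc _ ≤ ‖a‖ * (ε / (‖a‖ + 1) * ‖ξ‖) :=
        (ContinuousLinearMap.le_of_opNorm_le _ (NonUnitalStarAlgHom.norm_apply_le _ _) _).trans
          (by gcongr; exact hm n hn f ξ)
    _ ≤ (‖a‖ + 1) * (ε / (‖a‖ + 1) * ‖ξ‖) := by gcongr; linarith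
    _ = ε * ‖ξ‖ := by field_simp

theorem vanishesAtInfinity_of_mem_redundancyIdeal {t : E.Toeplitz}
    (ht : t ∈ E.redundancyIdeal) : E.VanishesAtInfinity t := by
  -- Vanishing at infinity is stable under left multiplication, but stability under right
  -- multiplication is not automatic. It is therefore built into the candidate ideal.
  let Z : Set E.Toeplitz :=
    {t | E.VanishesAtInfinity t ∧ ∀ s, E.VanishesAtInfinity (t * s)}
  let I : TwoSidedIdeal E.Toeplitz := TwoSidedIdeal.mk' Z
    ⟨E.vanishesAtInfinity_zero, fun s => by rw [zero_mul]; exact E.vanishesAtInfinity_zero⟩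
    (fun hx hy => ⟨hx.1.add hy.1, fun s => by rw [add_mul]; exact (hx.2 s).add (hy.2 s)⟩)
    (fun hx => ⟨hx.1.neg, fun s => by rw [neg_mul]; exact (hx.2 s).neg⟩)
    (fun hy => ⟨hy.1.mul_left _, fun s => by rw [mul_assoc]; exact (hy.2 s).mul_left _⟩)
    (fun hx => ⟨hx.2 _, fun s => by rw [mul_assoc]; exact hx.2 _⟩)
  have hI : (I : Set E.Toeplitz) = Z := TwoSidedIdeal.coe_mk' _ _ _ _ _ _
  have h : t ∈ (I : Set E.Toeplitz) := by
    refine mem_of_mem_redundancyIdeal ?_ (fun a k ha hk => ?_) ht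
    · rw [hI]
      have hZ : Z = {t | E.VanishesAtInfinity t} ∩
          ⋂ s, (fun t => t * s) ⁻¹' {t | E.VanishesAtInfinity t} := by
        ext t
        simp [Z]
      rw [hZ]
      exact E.isClosed_vanishesAtInfinity.inter (isClosed_iInter fun s =>
        E.isClosed_vanishesAtInfinity.preimage (continuous_mul_const s))
    · rw [← SetLike.mem_coe, hI]
      exact ⟨hk.vanishesAtInfinity, hk.vanishesAtInfinity_mul⟩
  rw [hI] at h
  exact h.1

end Vanishing

end ExelSystem

/-! ### The kernel of the canonical map, and almost faithfulness. -/

namespace ExelSystem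

open Filter Topology

variable {A : Type u} [NonUnitalCStarAlgebra A] (E : ExelSystem A)

/-- The elements of `A` which, together with their adjoints, become zero in the crossed product. -/
noncomputable def kernel : NonUnitalStarSubalgebra ℂ A where
  carrier := {c | E.i c ∈ E.redundancyIdeal ∧ E.i (star c) ∈ E.redundancyIdeal}
  add_mem' {x y} hx hy := ⟨by rw [map_add]; exact add_mem hx.1 hy.1, by
    rw [star_add, map_add]; exact add_mem hx.2 hy.2⟩
  zero_mem' := ⟨by rw [map_zero]; exact zero_mem _, by rw [star_zero, map_zero]; exact zero_mem _⟩
  mul_mem' {x y} hx hy := ⟨by rw [map_mul]; exact TwoSidedIdeal.mul_mem_left _ _ _ hy.1, by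
    rw [star_mul, map_mul]; exact TwoSidedIdeal.mul_mem_left _ _ _ hx.2⟩
  smul_mem' r x hx := by
    -- A two-sided ideal here is only an ideal of a ring. Scalars are absorbed by writing `(r c)e =
    -- c(r e)` and letting `e` run through an approximate unit.
    have key : ∀ (r : ℂ) (c : A), E.i c ∈ E.redundancyIdeal → E.i (r • c) ∈ E.redundancyIdeal := by
      intro r c hc
      obtain ⟨l, hl, -, -⟩ := exists_approximate_unit A
      have := hl.neBot
      have hi : Continuous E.i := AddMonoidHomClass.continuous_of_bound E.i 1
        (fun a => by simpa using NonUnitalStarAlgHom.norm_apply_le E.i a)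
      refine E.isClosed_redundancyIdeal.mem_of_tendsto
        ((hi.tendsto _).comp (hl.tendsto_mul_left (r • c))) (Eventually.of_forall fun e => ?_)
      rw [Function.comp_apply, smul_mul_assoc, ← mul_smul_comm, map_mul]
      exact TwoSidedIdeal.mul_mem_right _ _ _ hc
    exact ⟨key r x hx.1, by rw [star_smul]; exact key _ _ hx.2⟩
  star_mem' hx := ⟨hx.2, by rw [star_star]; exact hx.1⟩

theorem isClosed_kernel : IsClosed (E.kernel : Set A) := by
  have hi : Continuous E.i := AddMonoidHomClass.continuous_of_bound E.i 1
    (fun a => by simpa using NonUnitalStarAlgHom.norm_apply_le E.i a)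
  exact (E.isClosed_redundancyIdeal.preimage hi).inter
    (E.isClosed_redundancyIdeal.preimage (hi.comp continuous_star))

variable {E}

theorem star_mul_self_mem_kernel {c : A} (hc : E.i c ∈ E.redundancyIdeal) :
    star c * c ∈ E.kernel := by
  have h : E.i (star c * c) ∈ E.redundancyIdeal := by
    rw [map_mul]; exact TwoSidedIdeal.mul_mem_left _ _ _ hc
  exact ⟨h, by rwa [(IsSelfAdjoint.star_mul_self c).star_eq]⟩

theorem L_conj_mem_redundancyIdeal {c : A} (hc : E.i c ∈ E.redundancyIdeal) (x y : A) :
    E.i (E.L (star x * (c * y))) ∈ E.redundancyIdeal := by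
  have h : E.i (E.L (star x * (c * y))) =
      star (E.universalRep.πV x) * (E.i c * E.universalRep.πV y) := by
    refine (E.universalRep.star_πV_mul_πV x (c * y)).symm.trans ?_
    rw [← ToeplitzRep.π_mul_πV]
    rfl
  rw [h]
  exact TwoSidedIdeal.mul_mem_left _ _ _ (TwoSidedIdeal.mul_mem_right _ _ _ hc)

/-- The image under `i` is `(i(cx)S)* i(c) i(x)S`, which contains the factor `i(c)` from the ideal.
This invariance drives the induction on the powers of `L`. -/
theorem L_conj_mem_kernel {c : A} (hc : c ∈ E.kernel) (x : A) :
    E.L (star (c * x) * (c * x)) ∈ E.kernel := by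
  have h : E.i (E.L (star (c * x) * (c * x))) ∈ E.redundancyIdeal :=
    L_conj_mem_redundancyIdeal hc.1 _ _
  exact ⟨h, by rwa [E.star_L]⟩

variable (E)

section Order

variable [PartialOrder A] [StarOrderedRing A]

/-- Almost faithfulness reduces `c = 0` to `L((cx)*cx) = 0` for all `x`. These elements again lie in
the kernel, and vanishing of `c` for `f ∘ L ^ (n + 1)` passes to them for `f ∘ L ^ n`. -/
theorem eq_zero_of_forall_iter (hL : E.AlmostFaithfulOn E.Kα) (n : ℕ) :
    ∀ c ∈ E.kernel, (∀ (f : A →ₚ[ℂ] ℂ) (b : A), E.iter f n (star (c * b) * (c * b)) = 0) →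
      c = 0 := by
  induction n with
  | zero => exact fun c _ h => eq_zero_of_forall_functional_mul h
  | succ n ih =>
    intro c hc h
    refine hL c (E.mem_Kα_of_i_mem hc.1) fun x => ih _ (L_conj_mem_kernel hc x) fun f b => ?_
    obtain ⟨e, he⟩ := E.positive (c * x)
    rw [he]
    -- With `d = L((cx)*cx) = e*e`, the element `(db)*db` is dominated by a multiple of `b*db`. The
    -- transfer identity gives `b*db = L((cxα(b))*(cxα(b)))`, where the hypothesis applies.
    have h1 : star (star e * e * b) * (star e * e * b) ≤
        ‖e * star e‖ • (star (e * b) * (e * b)) := by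
      have := CStarAlgebra.star_left_conjugate_le_norm_smul (a := e * b) (b := e * star e)
        (hb := IsSelfAdjoint.mul_star_self e)
      simpa only [star_mul, star_star, mul_assoc] using this
    have h2 : E.iter f n (star (e * b) * (e * b)) = 0 := by
      have h3 : star (e * b) * (e * b) =
          E.L (star (c * (x * E.α b)) * (c * (x * E.α b))) := by
        rw [← mul_assoc c x, star_mul (c * x), mul_assoc (star (E.α b)),
          ← mul_assoc (star (c * x)) (c * x), ← map_star, E.L_map_mul, E.L_mul_α, he, star_mul]
        simp only [mul_assoc]
      rw [h3]
      exact h f (x * E.α b)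
    have h4 := OrderHomClass.mono (E.iter f n) h1
    rw [← Complex.coe_smul, map_smul, h2, smul_zero] at h4
    exact le_antisymm h4 ((E.iter f n).map_nonneg (star_mul_self_nonneg _))

/-- The direct sum over all functionals `f` of the GNS representations of `f ∘ L ^ n`. -/
noncomputable def iterHom (n : ℕ) :
    A →⋆ₙₐ[ℂ] lp (fun f : A →ₚ[ℂ] ℂ => (E.iter f n).GNS →L[ℂ] (E.iter f n).GNS) ∞ where
  toFun a := ⟨fun f => (E.iter f n).gnsNonUnitalStarAlgHom a, memℓp_infty ⟨‖a‖, by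
    rintro _ ⟨f, rfl⟩; exact NonUnitalStarAlgHom.norm_apply_le _ _⟩⟩
  map_smul' c a := by ext1; funext f; exact map_smul (E.iter f n).gnsNonUnitalStarAlgHom c a
  map_zero' := by ext1; funext f; exact map_zero (E.iter f n).gnsNonUnitalStarAlgHom
  map_add' a b := by ext1; funext f; exact map_add (E.iter f n).gnsNonUnitalStarAlgHom a b
  map_mul' a b := by ext1; funext f; exact map_mul (E.iter f n).gnsNonUnitalStarAlgHom a b
  map_star' a := by ext1; funext f; exact map_star (E.iter f n).gnsNonUnitalStarAlgHom a

theorem iterHom_apply (n : ℕ) (a : A) (f : A →ₚ[ℂ] ℂ) :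
    E.iterHom n a f = (E.iter f n).gnsNonUnitalStarAlgHom a := rfl

/-- The previous vanishing result says that the combined representation is injective on the kernel.
An injective homomorphism of `C⋆`-algebras is isometric. -/
theorem norm_iterHom (hL : E.AlmostFaithfulOn E.Kα) (n : ℕ) {c : A} (hc : c ∈ E.kernel) :
    ‖E.iterHom n c‖ = ‖c‖ := by
  let _ : NonUnitalCStarAlgebra E.kernel :=
    NonUnitalStarSubalgebra.nonUnitalCStarAlgebra E.kernel (h_closed := E.isClosed_kernel)
  let g := (E.iterHom n).comp (NonUnitalStarSubalgebraClass.subtype E.kernel)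
  have hg : Function.Injective g := by
    refine (injective_iff_map_eq_zero g).2 fun x hx => Subtype.ext ?_
    refine E.eq_zero_of_forall_iter hL n x x.2 fun f => (gns_apply_eq_zero_iff _).1 ?_
    rw [← iterHom_apply]
    exact congrArg (fun y : lp (fun f : A →ₚ[ℂ] ℂ =>
      (E.iter f n).GNS →L[ℂ] (E.iter f n).GNS) ∞ => y f) hx
  exact NonUnitalStarAlgHom.norm_map g hg ⟨c, hc⟩

/-- The norm of `c` can be read off on summand `n` for every `n`, uniformly over functionals, while
membership of `i(c)` in the ideal makes that norm small for large `n`. -/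
theorem eq_zero_of_mem_kernel (hL : E.AlmostFaithfulOn E.Kα) {c : A} (hc : c ∈ E.kernel) :
    c = 0 := by
  rw [← norm_eq_zero]
  refine le_antisymm (le_of_forall_pos_le_add fun ε hε => ?_) (norm_nonneg c)
  obtain ⟨n, hn⟩ := vanishesAtInfinity_of_mem_redundancyIdeal hc.1 ε hε
  rw [zero_add, ← E.norm_iterHom hL n hc]
  refine lp.norm_le_of_forall_le hε.le fun f => ?_
  refine ContinuousLinearMap.opNorm_le_bound _ hε.le fun ξ => ?_
  have h := hn n le_rfl f ξ
  rwa [fockHom_i, fock_π_single, norm_fock_single] at h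

end Order

theorem injective_Q_comp_i_iff_almostFaithfulOn :
    Function.Injective (E.Q ∘ E.i) ↔ E.AlmostFaithfulOn E.Kα := by
  let _ := CStarAlgebra.spectralOrder A
  let _ := CStarAlgebra.spectralOrderedRing A
  rw [injective_Q_comp_i_iff]
  constructor
  · intro h a ha hb
    refine h a ?_
    have := sub_mem_redundancyIdeal ha.1 (E.isRedundancy_zero hb)
    rwa [sub_zero] at this
  · intro hL c hc
    -- Passing to `c*c` supplies the condition on the adjoint in `kernel`, with no need to know that
    -- the redundancy ideal is self-adjoint.
    have h := E.eq_zero_of_mem_kernel hL (star_mul_self_mem_kernel hc)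
    exact CStarRing.star_mul_self_eq_zero_iff c |>.1 h

/-- Commutativity turns `ab` into `ba`, and `‖L((ba)*ba)‖ ≤ ‖b‖²‖L(a*a)‖`. In the other direction
`b` runs through an approximate unit, which needs only continuity of `L`. -/
theorem almostFaithfulOn_iff_faithfulOn (hA : ∀ a b : A, a * b = b * a) (I : Submodule ℂ A) :
    E.AlmostFaithfulOn I ↔ E.FaithfulOn I := by
  constructor
  · intro h a ha h0
    refine h a ha fun b => norm_le_zero_iff.1 ?_
    rw [hA a b]
    refine (E.norm_L_le b a).trans_eq ?_
    rw [h0, norm_zero, mul_zero]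
  · intro h a ha h0
    refine h a ha ?_
    obtain ⟨l, hl, -, -⟩ := exists_approximate_unit A
    have := hl.neBot
    have h1 := hl.tendsto_mul_left a
    have h2 : Tendsto (fun e => E.L (star (a * e) * (a * e))) l (𝓝 (E.L (star a * a))) :=
      (E.L.continuous.tendsto _).comp (h1.star.mul h1)
    simp only [h0] at h2
    exact (tendsto_nhds_unique tendsto_const_nhds h2).symm

end ExelSystem

theorem theorem4p3 {A : Type u} [NonUnitalCStarAlgebra A] (E : ExelSystem A) :
    (Function.Injective (E.Q ∘ E.i) ↔ E.AlmostFaithfulOn E.Kα) ∧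
      ((∀ a b : A, a * b = b * a) →
        (Function.Injective (E.Q ∘ E.i) ↔ E.FaithfulOn E.Kα)) :=
  ⟨E.injective_Q_comp_i_iff_almostFaithfulOn, fun hA =>
    E.injective_Q_comp_i_iff_almostFaithfulOn.trans (E.almostFaithfulOn_iff_faithfulOn hA _)⟩
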